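/- Consider a finite two-player zero-sum extensive-form game with perfect recall, with chance moves allowed and at least one action at every decision point. Player 1 is the minimizer, player 2 the maximizer. For player $i$ let $\mathbb H_i$ be the set of decision points (information sets), $\mathcal A_i(h)$ the actions at $h\in\mathbb H_i$, and $p(h)$ the parent sequence of $h$: the last pair (own decision point, own action) preceding $h$, or the root sequence $\varnothing$ if there is none. The sequences of player $i$ are $\varnothing$ and all pairs $(h,a)$ with $h\in\mathbb H_i$, $a\in\mathcal A_i(h)$. Let - $\mathcal X$ (player 1) and $\mathcal Y$ (player 2) be the sequence-form polytopes: the nonnegative vectors $x$, indexed by the player's sequences, with $x^{\varnothing}=1$ and $\sum_{a}x^{(h,a)}=x^{p(h)}$ for all $h$; and $\mathcal Z=\mathcal X\times\mathcal Y$; - $A$ be the sequence-form payoff matrix: $A_{ij}$ is the sum, over all leaves whose last sequences are $i$ for player 1 and $j$ for player 2, of the chance probability of the leaf times the payoff of player 2; and $F(x,y)=(Ay,-A^{\top}x)$; - $\psi(x,y)=\psi_1(x)+\psi_2(y)$, where $\psi_i(x)=\sum_{h\in\mathbb H_i}x^{p(h)}\sum_{a}\frac{x^{(h,a)}}{x^{p(h)}}\log\frac{x^{(h,a)}}{x^{p(h)}}$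 is the dilated entropy with unit weights (with $0\log 0=0$, and value $+\infty$ off its natural domain); - $\|(x,y)\|=\sqrt{\|x\|_1^2+\|y\|_1^2}$, and $\|\cdot\|_*$ its dual norm. The pure strategies of player $i$ in the reduced normal form choose an action at exactly those decision points of player $i$ that are not excluded by the player's own earlier choices. For $\alpha>0$, an $\alpha$-QRE of the reduced normal form is a pair of mixed strategies over these pure strategies such that each player's mixed strategy maximizes, against that of the opponent, the player's expected payoff plus $\alpha$ times the Shannon entropy of the mixed strategy. A solution of $\operatorname{VI}(\mathcal Z,F+\alpha\nabla\psi)$ is a point $z_*\in\mathcal Z\cap\operatorname{int}\operatorname{dom}\psi$ with $\langle F(z_*)+\alpha\nabla\psi(z_*),z-z_*\rangle\ge 0$ for all $z\in\mathcal Z$. Then the following hold. 1. For every $\alpha>0$, finding an $\alpha$-QRE of the reduced normal form is equivalent to solving $\operatorname{VI}(\mathcal Z,F+\alpha\nabla\psi)$: the map that sends a pair of mixed strategies to the pair of its sequence-form strategies (the probabilities that the sequences are played) is a bijection from the set of $\alpha$-QREs onto the set of solutions of the VI. Moreover, a joint policy $(\pi_1,\pi_2)$, with $\pi_i(h)$ a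 probability distribution on $\mathcal A_i(h)$ for every $h\in\mathbb H_i$, induces an $\alpha$-QRE (through the mixtures over pure strategies obtained by drawing the actions at the decision points independently) if and only if its sequence form, given by $x^{\varnothing}=1$ and $x^{(h,a)}=x^{p(h)}\pi_i(h,a)$, solves the VI. 2. $\psi$ is differentiable on $\operatorname{int}\operatorname{dom}\psi$ and strongly convex over $\mathcal Z$ with respect to $\|\cdot\|$: there is $\mu>0$ with $\psi(z)-\psi(z')-\langle\nabla\psi(z'),z-z'\rangle\ge\frac{\mu}{2}\|z-z'\|^2$ for all $z\in\mathcal Z$ and $z'\in\mathcal Z\cap\operatorname{int}\operatorname{dom}\psi$. 3. $F$ is monotone, $\langle F(z)-F(z'),z-z'\rangle\ge 0$, and $\max_{i,j}|A_{ij}|$-smooth, $\|F(z)-F(z')\|_*\le \max_{i,j}|A_{ij}|\,\|z-z'\|$, for all $z,z'$. 4. For every $\alpha>0$, $F+\alpha\nabla\psi$ is strongly monotone: there is $\mu>0$ with $\langle G(z)-G(z'),z-z'\rangle\ge\mu\|z-z'\|^2$ for $G=F+\alpha\nabla\psi$ and all $z,z'\in\mathcal Z\cap\operatorname{int}\operatorname{dom}\psi$.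 -/

import Mathlib

open scoped Matrix

noncomputable section

/-! ## Finite-dimensional product spaces and variational inequalities -/

section VI

variable {ι κ : Type*} [Fintype ι] [Fintype κ]

/-- The standard inner product on `ℝ^ι × ℝ^κ`. -/
def ip (u v : (ι → ℝ) × (κ → ℝ)) : ℝ := u.1 ⬝ᵥ v.1 + u.2 ⬝ᵥ v.2

/-- The `ℓ₁`-norm on `ℝ^ι`. -/
def l1 (x : ι → ℝ) : ℝ := ∑ i, |x i|

/-- The `ℓ₁`-product norm `‖(x, y)‖ = √(‖x‖₁² + ‖y‖₁²)`. -/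
def prodNorm (z : (ι → ℝ) × (κ → ℝ)) : ℝ := Real.sqrt (l1 z.1 ^ 2 + l1 z.2 ^ 2)

/-- The dual norm `‖w‖_* = sup {⟨w, v⟩ : ‖v‖ = 1}` of the `ℓ₁`-product norm. -/
def dualNorm (w : (ι → ℝ) × (κ → ℝ)) : ℝ :=
  sSup {r | ∃ v : (ι → ℝ) × (κ → ℝ), prodNorm v = 1 ∧ r = ip w v}

/-- The gradient (vector of partial derivatives) of `f : ℝ^ι × ℝ^κ → ℝ`. -/
def grad [DecidableEq ι] [DecidableEq κ] (f : (ι → ℝ) × (κ → ℝ) → ℝ)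
    (z : (ι → ℝ) × (κ → ℝ)) : (ι → ℝ) × (κ → ℝ) :=
  (fun i => fderiv ℝ f z (Pi.single i 1, 0), fun j => fderiv ℝ f z (0, Pi.single j 1))

/-- The Bregman divergence `B_f(x; y)`. -/
def bregman [DecidableEq ι] [DecidableEq κ] (f : (ι → ℝ) × (κ → ℝ) → ℝ)
    (x y : (ι → ℝ) × (κ → ℝ)) : ℝ := f x - f y - ip (grad f y) (x - y)

/-- `f`, differentiable on the open set `D`, is `μ`-strongly convex over `C` with respect to the
`ℓ₁`-product norm: `B_f(x; y) ≥ (μ / 2) ‖x - y‖²` for `x ∈ C`, `y ∈ C ∩ D`. -/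
def StronglyConvexOver [DecidableEq ι] [DecidableEq κ] (f : (ι → ℝ) × (κ → ℝ) → ℝ)
    (C D : Set ((ι → ℝ) × (κ → ℝ))) (μ : ℝ) : Prop :=
  ∀ x ∈ C, ∀ y ∈ C ∩ D, μ / 2 * prodNorm (x - y) ^ 2 ≤ bregman f x y

/-- The operator `G`, with domain of definition `S`, satisfies
`⟨G z - G z', z - z'⟩ ≥ μ ‖z - z'‖²`. For `μ > 0` this is strong monotonicity,
for `μ = 0` monotonicity. -/
def IsMonotoneOp (G : (ι → ℝ) × (κ → ℝ) → (ι → ℝ) × (κ → ℝ))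
    (S : Set ((ι → ℝ) × (κ → ℝ))) (μ : ℝ) : Prop :=
  ∀ z ∈ S, ∀ z' ∈ S, μ * prodNorm (z - z') ^ 2 ≤ ip (G z - G z') (z - z')

/-- The operator `G`, with domain of definition `S`, is `L`-smooth:
`‖G z - G z'‖_* ≤ L ‖z - z'‖`. -/
def IsSmoothOp (G : (ι → ℝ) × (κ → ℝ) → (ι → ℝ) × (κ → ℝ))
    (S : Set ((ι → ℝ) × (κ → ℝ))) (L : ℝ) : Prop :=
  ∀ z ∈ S, ∀ z' ∈ S, dualNorm (G z - G z') ≤ L * prodNorm (z - z')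

/-- The solutions of `VI(Z, G)`, where `G` is defined on `Z ∩ D`: the points `z` of `Z` at which
`G` is defined and `⟨G z, z' - z⟩ ≥ 0` for all `z' ∈ Z`. -/
def viSolutions (Z D : Set ((ι → ℝ) × (κ → ℝ)))
    (G : (ι → ℝ) × (κ → ℝ) → (ι → ℝ) × (κ → ℝ)) : Set ((ι → ℝ) × (κ → ℝ)) :=
  {z | z ∈ Z ∩ D ∧ ∀ z' ∈ Z, 0 ≤ ip (G z) (z' - z)}

end VI

/-! ## Extensive-form games -/

/-- Finite game trees for two players `0` and `1`, with chance moves. `H i` is the set of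
decision points (information sets) of player `i`, and `Act i h` the set of actions at `h`.
* `leaf u`: the game ends, player `1` gets `u`, player `0` gets `-u`.
* `chance k p c`: chance moves to the subtree `c j` with probability `p j`.
* `node i h c`: a node of the information set `h` of player `i`; action `a` leads to `c a`. -/
inductive GameTree {H : Fin 2 → Type*} (Act : ∀ i, H i → Type*) where
  | leaf (u : ℝ) : GameTree Act
  | chance (k : ℕ) (p : Fin k → ℝ) (c : Fin k → GameTree Act) : GameTree Act
  | node (i : Fin 2) (h : H i) (c : Act i h → GameTree Act) : GameTree Act

section Game

variable {H : Fin 2 → Type*} {Act : ∀ i, H i → Type*}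

/-- `Occurs T S l`: the tree `T` has a node at which the subtree `S` is rooted, and `l i` is the
list of the pairs (information set, action chosen there) of player `i` on the path from the root
to that node, the most recent one first. -/
inductive GameTree.Occurs (T : GameTree Act) :
    GameTree Act → (∀ i, List (Σ h : H i, Act i h)) → Prop
  | root : Occurs T T (fun _ => [])
  | chance {k : ℕ} {p : Fin k → ℝ} {c : Fin k → GameTree Act}
      {l : ∀ i, List (Σ h : H i, Act i h)} (j : Fin k) :
      Occurs T (.chance k p c) l → Occurs T (c j) l
  | node {i : Fin 2} {h : H i} {c : Act i h → GameTree Act}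
      {l : ∀ i, List (Σ h : H i, Act i h)} (a : Act i h) :
      Occurs T (.node i h c) l → Occurs T (c a) (Function.update l i (⟨h, a⟩ :: l i))

/-- Two-player zero-sum extensive-form games with perfect recall. -/
structure ZeroSumEFG (Act : ∀ i, H i → Type*) where
  tree : GameTree Act
  chance_prob : ∀ (k : ℕ) (p : Fin k → ℝ) (c : Fin k → GameTree Act)
    (l : ∀ i, List (Σ h : H i, Act i h)),
    tree.Occurs (.chance k p c) l → p ∈ stdSimplex ℝ (Fin k)
  infoset_nonempty : ∀ (i : Fin 2) (h : H i), ∃ (l : ∀ i, List (Σ h : H i, Act i h))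
    (c : Act i h → GameTree Act), tree.Occurs (.node i h c) l
  /-- At any two nodes of the same information set, the player has the same record of own past
  information sets and actions. -/
  perfect_recall : ∀ (i : Fin 2) (h : H i) (c c' : Act i h → GameTree Act)
    (l l' : ∀ i, List (Σ h : H i, Act i h)),
    tree.Occurs (.node i h c) l → tree.Occurs (.node i h c') l' → l i = l' i

/-- Sequences of player `i`: the root sequence `∅` (`none`) and the pairs `(h, a)`. -/
abbrev Sequence (Act : ∀ i, H i → Type*) (i : Fin 2) : Type _ := Option (Σ h : H i, Act i h)

/-! ### Pure strategies of the reduced normal form -/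

/-- The partial choice function `σ` plays the sequence `s`. -/
def Plays {i : Fin 2} (σ : ∀ h : H i, Option (Act i h)) : Sequence Act i → Prop
  | none => True
  | some ⟨h, a⟩ => σ h = some a

namespace ZeroSumEFG

variable (G : ZeroSumEFG Act)

/-- The record of own past information sets and actions of player `i` at `h`, the most recent
first. By perfect recall it does not depend on the chosen node of `h`. -/
def record (i : Fin 2) (h : H i) : List (Σ h : H i, Act i h) :=
  (G.infoset_nonempty i h).choose i

/-- The parent sequence `p(h)`. -/
def parent (i : Fin 2) (h : H i) : Sequence Act i := (G.record i h).head?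

/-- Pure strategies of the reduced normal form: choices of an action at exactly those decision
points which the player's own earlier choices leave reachable. -/
def Plan (i : Fin 2) : Type _ :=
  {σ : ∀ h : H i, Option (Act i h) // ∀ h, (σ h).isSome ↔ Plays σ (G.parent i h)}

end ZeroSumEFG

variable [∀ i, Fintype (H i)] [∀ i, DecidableEq (H i)]
  [∀ i h, Fintype (Act i h)] [∀ i h, DecidableEq (Act i h)]

/-- The expected payoff of player `1` (over chance moves) when the players use the pure strategies
`σ`. The value `0` at a node where `σ` is undefined is never used for plans: such nodes are
not reached. -/
def GameTree.payoff (σ : ∀ i (h : H i), Option (Act i h)) : GameTree Act → ℝ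
  | .leaf u => u
  | .chance _ p c => ∑ j, p j * (c j).payoff σ
  | .node i h c => (σ i h).elim 0 (fun a => (c a).payoff σ)

/-- The sequence-form payoff matrix of a subtree whose root is reached with the current sequences
`s`: the entry at a pair of sequences is the sum over all leaves with these last sequences
of (chance probability) × (payoff of player `1`). -/
def GameTree.payoffMatrix :
    GameTree Act → (∀ i, Sequence Act i) → Matrix (Sequence Act 0) (Sequence Act 1) ℝ
  | .leaf u, s => Matrix.single (s 0) (s 1) u
  | .chance _ p c, s => ∑ j, p j • (c j).payoffMatrix s
  | .node i h c, s => ∑ a, (c a).payoffMatrix (Function.update s i (some ⟨h, a⟩))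

namespace ZeroSumEFG

variable (G : ZeroSumEFG Act)

instance (i : Fin 2) : Fintype (G.Plan i) :=
  @Fintype.ofFinite _ (inferInstanceAs (Finite
    {σ : ∀ h : H i, Option (Act i h) // ∀ h, (σ h).isSome ↔ Plays σ (G.parent i h)}))

/-! ### Quantal response equilibria of the reduced normal form -/

/-- Expected payoff of player `1` under the profile `m` of mixed strategies. -/
def value (m : ∀ i, G.Plan i → ℝ) : ℝ :=
  ∑ σ : (∀ i, G.Plan i), (∏ i, m i (σ i)) * G.tree.payoff (fun i => (σ i).1)

/-- Expected reward of player `i`; player `0` minimizes `value`, player `1` maximizes it. -/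
def reward (i : Fin 2) (m : ∀ i, G.Plan i → ℝ) : ℝ := if i = 0 then -G.value m else G.value m

/-- Shannon entropy of a mixed strategy. -/
def entropy {i : Fin 2} (q : G.Plan i → ℝ) : ℝ := ∑ σ, Real.negMulLog (q σ)

/-- Logit quantal response equilibria with temperature `α` of the reduced normal form: each player
maximizes expected reward plus `α` times the entropy of the own mixed strategy. -/
def IsQRE (α : ℝ) (m : ∀ i, G.Plan i → ℝ) : Prop :=
  ∀ i, m i ∈ stdSimplex ℝ (G.Plan i) ∧ ∀ q ∈ stdSimplex ℝ (G.Plan i),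
    G.reward i (Function.update m i q) + α * G.entropy q ≤ G.reward i m + α * G.entropy (m i)

/-! ### The sequence form -/

/-- The sequence-form strategy polytope of player `i`. -/
def polytope (i : Fin 2) : Set (Sequence Act i → ℝ) :=
  {x | (∀ s, 0 ≤ x s) ∧ x none = 1 ∧ ∀ h, ∑ a, x (some ⟨h, a⟩) = x (G.parent i h)}

/-- `Z = X × Y`. -/
def Z : Set ((Sequence Act 0 → ℝ) × (Sequence Act 1 → ℝ)) := G.polytope 0 ×ˢ G.polytope 1

/-- The sequence-form payoff matrix. -/
def A : Matrix (Sequence Act 0) (Sequence Act 1) ℝ := G.tree.payoffMatrix (fun _ => none)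

/-- `F(x, y) = (∇ₓ(xᵀAy), -∇_y(xᵀAy)) = (A y, -Aᵀ x)`. -/
def F (z : (Sequence Act 0 → ℝ) × (Sequence Act 1 → ℝ)) :
    (Sequence Act 0 → ℝ) × (Sequence Act 1 → ℝ) :=
  (G.A *ᵥ z.2, -(G.Aᵀ *ᵥ z.1))

/-- The dilated entropy `∑ₕ x^{p(h)} ψₕ(xʰ / x^{p(h)})` with `ψₕ(q) = ∑ₐ qₐ log qₐ` and all
weights equal to `1`. -/
def dilatedEntropy (i : Fin 2) (x : Sequence Act i → ℝ) : ℝ :=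
  ∑ h : H i, x (G.parent i h) *
    ∑ a, (x (some ⟨h, a⟩) / x (G.parent i h)) * Real.log (x (some ⟨h, a⟩) / x (G.parent i h))

/-- The effective domain of the dilated entropy (as a closed convex function, with `0 log 0 = 0`);
outside it the dilated entropy is `+∞`. -/
def entropyDom (i : Fin 2) : Set (Sequence Act i → ℝ) :=
  {x | ∀ (h : H i) (a : Act i h), 0 ≤ x (G.parent i h) ∧ 0 ≤ x (some ⟨h, a⟩) ∧
    (x (G.parent i h) = 0 → x (some ⟨h, a⟩) = 0)}

/-- The sum of the dilated entropies of the two players. -/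
def psi (z : (Sequence Act 0 → ℝ) × (Sequence Act 1 → ℝ)) : ℝ :=
  G.dilatedEntropy 0 z.1 + G.dilatedEntropy 1 z.2

/-- The interior of the domain of `psi`. -/
def intDom : Set ((Sequence Act 0 → ℝ) × (Sequence Act 1 → ℝ)) :=
  interior (G.entropyDom 0 ×ˢ G.entropyDom 1)

/-! ### Passing between the reduced normal form, policies, and the sequence form -/

open Classical in
/-- The sequence-form strategy of a mixed strategy: the probability that `s` is played. -/
def realization {i : Fin 2} (q : G.Plan i → ℝ) (s : Sequence Act i) : ℝ :=
  ∑ σ : G.Plan i, if Plays σ.1 s then q σ else 0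

/-- The pair of sequence-form strategies of a mixed strategy profile. -/
def realizationPair (m : ∀ i, G.Plan i → ℝ) :
    (Sequence Act 0 → ℝ) × (Sequence Act 1 → ℝ) :=
  (G.realization (m 0), G.realization (m 1))

/-- The mixture of plans equivalent to a policy `π` (draw the actions at the decision points
independently according to `π`). -/
def mixture {i : Fin 2} (π : ∀ h : H i, Act i h → ℝ) (σ : G.Plan i) : ℝ :=
  ∏ h : H i, (σ.1 h).elim 1 (π h)

/-- The sequence form of a policy: `x^∅ = 1` and `x^{(h,a)}` is the product of the probabilities of
all own actions up to and including `a` at `h`. -/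
def sequenceForm {i : Fin 2} (π : ∀ h : H i, Act i h → ℝ) : Sequence Act i → ℝ
  | none => 1
  | some ⟨h, a⟩ => ((G.record i h).map (fun q => π q.1 q.2)).prod * π h a

end ZeroSumEFG

end Game

end

set_option linter.unusedSectionVars false

/-! Against a fixed opponent the payoff is linear in a player's sequence-form vector, so the
equivalence reduces to one player facing a linear cost `c`. Let `x` be a positive point of the
polytope and `p` the product mixture of its policy. By `log_mixture` and `entropyDeriv_eq`, `log (p
σ)` is the derivative of the dilated entropy at `x` in the direction of the 0-1 vector of the plan
`σ`. Hence the logit condition, that `⟨c, σ⟩ + α log (p σ)` does not depend on `σ`, says that `c + α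
∇ψ(x)` is constant on the plan vectors. Their mixtures fill the polytope and all weights of `p` are
positive, so this is the variational inequality (`IsLogit.solvesVI`, `SolvesVI.isLogit`). Moreover a
logit response `q` is the product mixture `p` with the same realization: the relative entropy of `q`
to `p` equals the entropy of `p` minus that of `q`, and optimality of `q` makes it nonpositive
(`IsLogit.mixture_ratio_realization`). So `q` is recovered from its sequence form.

The Bregman divergence of the dilated entropy is a sum of relative entropies of the local policies,
weighted by reach probabilities (`le_bregman_dilatedEntropy`). Accumulating local errors along paths
turns this into an `ℓ₁` bound, hence strong convexity. The operator `F` is linear and skew, hence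
monotone, and adding `α ∇ψ` makes it strongly monotone. -/

/-! ## Divergence estimates -/

/-- A quadratic lower bound for the scalar relative entropy on `[0, 1]`. -/
theorem sq_sub_le_mul_log_sub {p q : ℝ} (hp : 0 ≤ p) (hp1 : p ≤ 1) (hq : 0 < q) (hq1 : q ≤ 1) :
    (p - q) ^ 2 / 4 ≤ p * (Real.log p - Real.log q) - p + q := by
  -- With `p = a²` and `q = b²`, the bound `log (b / a) ≤ b / a - 1` makes the right side at least
  -- `(a - b)²`, and `a + b ≤ 2` compares this with `(a² - b²)² / 4`.
  obtain ⟨a, ha, rfl⟩ : ∃ a : ℝ, 0 ≤ a ∧ p = a ^ 2 :=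
    ⟨√p, Real.sqrt_nonneg p, (Real.sq_sqrt hp).symm⟩
  obtain ⟨b, hb, rfl⟩ : ∃ b : ℝ, 0 < b ∧ q = b ^ 2 :=
    ⟨√q, Real.sqrt_pos.2 hq, (Real.sq_sqrt hq.le).symm⟩
  have ha1 : a ≤ 1 := by nlinarith
  have hb1 : b ≤ 1 := by nlinarith
  have key : a ^ 2 - a * b ≤ a ^ 2 * (Real.log a - Real.log b) := by
    rcases ha.eq_or_lt with rfl | ha
    · simp
    · have h := Real.log_le_sub_one_of_pos (div_pos hb ha)
      rw [Real.log_div hb.ne' ha.ne'] at h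
      have h2 := mul_le_mul_of_nonneg_left h (sq_nonneg a)
      have h3 : a ^ 2 * (b / a - 1) = a * b - a ^ 2 := by field_simp
      linarith
  have hsq : (a ^ 2 - b ^ 2) ^ 2 / 4 ≤ (a - b) ^ 2 := by
    have : (a + b) ^ 2 ≤ 4 := by nlinarith
    nlinarith [mul_le_mul_of_nonneg_left this (sq_nonneg (a - b))]
  rw [Real.log_pow, Real.log_pow]
  push_cast
  nlinarith

section Simplex

variable {ι : Type*} [Fintype ι]

theorem le_one_of_mem_stdSimplex {q : ι → ℝ} (hq : q ∈ stdSimplex ℝ ι) (j : ι) : q j ≤ 1 :=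
  hq.2 ▸ Finset.single_le_sum (fun k _ => hq.1 k) (Finset.mem_univ j)

/-- Gibbs' inequality with a quadratic remainder. -/
theorem sum_sq_sub_le_relativeEntropy {q p : ι → ℝ} (hq : q ∈ stdSimplex ℝ ι)
    (hp : p ∈ stdSimplex ℝ ι) (hpos : ∀ j, 0 < p j) :
    (∑ j, (q j - p j) ^ 2) / 4 ≤ ∑ j, q j * (Real.log (q j) - Real.log (p j)) := by
  have h : ∑ j, (q j - p j) ^ 2 / 4
      ≤ ∑ j, (q j * (Real.log (q j) - Real.log (p j)) - q j + p j) :=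
    Finset.sum_le_sum fun j _ => sq_sub_le_mul_log_sub (hq.1 j) (le_one_of_mem_stdSimplex hq j)
      (hpos j) (le_one_of_mem_stdSimplex hp j)
  rw [Finset.sum_add_distrib, Finset.sum_sub_distrib, hq.2, hp.2, ← Finset.sum_div] at h
  linarith

theorem relativeEntropy_nonneg {q p : ι → ℝ} (hq : q ∈ stdSimplex ℝ ι)
    (hp : p ∈ stdSimplex ℝ ι) (hpos : ∀ j, 0 < p j) :
    0 ≤ ∑ j, q j * (Real.log (q j) - Real.log (p j)) :=
  le_trans (div_nonneg (Finset.sum_nonneg fun _ _ => sq_nonneg _) (by norm_num))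
    (sum_sq_sub_le_relativeEntropy hq hp hpos)

theorem eq_of_relativeEntropy_nonpos {q p : ι → ℝ} (hq : q ∈ stdSimplex ℝ ι)
    (hp : p ∈ stdSimplex ℝ ι) (hpos : ∀ j, 0 < p j)
    (h : ∑ j, q j * (Real.log (q j) - Real.log (p j)) ≤ 0) : q = p := by
  have h1 := sum_sq_sub_le_relativeEntropy hq hp hpos
  have h2 : ∑ j, (q j - p j) ^ 2 = 0 :=
    le_antisymm (by linarith) (Finset.sum_nonneg fun _ _ => sq_nonneg _)
  rw [Finset.sum_eq_zero_iff_of_nonneg fun _ _ => sq_nonneg _] at h2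
  funext j
  exact sub_eq_zero.1 (pow_eq_zero_iff (two_ne_zero) |>.1 (h2 j (Finset.mem_univ j)))

/-- The entropy-regularized linear objective in terms of the relative entropy to a distribution
whose logarithm is, up to a constant, the gain vector. -/
theorem sum_mul_add_entropy_eq {g p q : ι → ℝ} {α c : ℝ} (hq : q ∈ stdSimplex ℝ ι)
    (h : ∀ j, g j - α * Real.log (p j) = c) :
    ∑ j, q j * g j + α * ∑ j, Real.negMulLog (q j)
      = c - α * ∑ j, q j * (Real.log (q j) - Real.log (p j)) := by
  have hc : c = ∑ j, q j * c := by rw [← Finset.sum_mul, hq.2, one_mul]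
  rw [hc, Finset.mul_sum, Finset.mul_sum, ← Finset.sum_add_distrib, ← Finset.sum_sub_distrib]
  refine Finset.sum_congr rfl fun j _ => ?_
  rw [← h j, Real.negMulLog]
  ring

theorem exists_softmax [Nonempty ι] (g : ι → ℝ) {α : ℝ} (hα : 0 < α) :
    ∃ p ∈ stdSimplex ℝ ι, (∀ j, 0 < p j) ∧ ∃ c, ∀ j, g j - α * Real.log (p j) = c := by
  set S := ∑ j, Real.exp (g j / α)
  have hS : 0 < S := Finset.sum_pos (fun _ _ => Real.exp_pos _) Finset.univ_nonempty
  have hpos : ∀ j, 0 < Real.exp (g j / α) / S := fun j => div_pos (Real.exp_pos _) hS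
  refine ⟨fun j => Real.exp (g j / α) / S, ⟨fun j => (hpos j).le, ?_⟩, hpos,
    α * Real.log S, fun j => ?_⟩
  · rw [← Finset.sum_div, div_self hS.ne']
  · rw [Real.log_div (Real.exp_pos _).ne' hS.ne', Real.log_exp]
    field_simp
    ring

/-- The maximizers of the entropy-regularized linear objective over the simplex. -/
theorem isMax_entropy_iff [Nonempty ι] (g : ι → ℝ) {α : ℝ} (hα : 0 < α) {p : ι → ℝ}
    (hp : p ∈ stdSimplex ℝ ι) :
    (∀ q ∈ stdSimplex ℝ ι, ∑ j, q j * g j + α * ∑ j, Real.negMulLog (q j)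
      ≤ ∑ j, p j * g j + α * ∑ j, Real.negMulLog (p j)) ↔
    (∀ j, 0 < p j) ∧ ∃ c, ∀ j, g j - α * Real.log (p j) = c := by
  constructor
  · intro h
    -- Comparing with the softmax avoids differentiating the entropy at the boundary: the objective
    -- at `p` falls short of its value at `p'` by `α` times the relative entropy.
    obtain ⟨p', hp', hpos, c, hc⟩ := exists_softmax g hα
    have h1 := h p' hp'
    rw [sum_mul_add_entropy_eq hp' hc, sum_mul_add_entropy_eq hp hc] at h1
    simp only [sub_self, mul_zero, Finset.sum_const_zero, sub_zero] at h1
    have h2 : ∑ j, p j * (Real.log (p j) - Real.log (p' j)) ≤ 0 := by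
      by_contra! h3
      linarith [mul_pos hα h3]
    rw [eq_of_relativeEntropy_nonpos hp hp' hpos h2]
    exact ⟨hpos, c, hc⟩
  · rintro ⟨hpos, c, hc⟩ q hq
    rw [sum_mul_add_entropy_eq hq hc, sum_mul_add_entropy_eq hp hc]
    simp only [sub_self, mul_zero, Finset.sum_const_zero, sub_zero]
    linarith [mul_nonneg hα.le (relativeEntropy_nonneg hq hp hpos)]

end Simplex

/-! ## Norms and gradients on a product -/

section Product

variable {ι κ : Type*} [Fintype ι] [Fintype κ]

theorem l1_nonneg (x : ι → ℝ) : 0 ≤ l1 x := Finset.sum_nonneg fun _ _ => abs_nonneg _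

theorem prodNorm_sq (z : (ι → ℝ) × (κ → ℝ)) : prodNorm z ^ 2 = l1 z.1 ^ 2 + l1 z.2 ^ 2 :=
  Real.sq_sqrt (add_nonneg (sq_nonneg _) (sq_nonneg _))

/-- Only linearity of `fderiv ℝ f z` is used, so no differentiability is needed. -/
theorem ip_grad [DecidableEq ι] [DecidableEq κ] (f : (ι → ℝ) × (κ → ℝ) → ℝ)
    (z v : (ι → ℝ) × (κ → ℝ)) : ip (grad f z) v = fderiv ℝ f z v := by
  have hv : v = ∑ i, v.1 i • ((Pi.single i 1, 0) : (ι → ℝ) × (κ → ℝ))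
      + ∑ j, v.2 j • ((0, Pi.single j 1) : (ι → ℝ) × (κ → ℝ)) := by
    ext k
    · simp [Prod.fst_sum, Pi.single_apply]
    · simp [Prod.snd_sum, Pi.single_apply]
  conv_rhs => rw [hv]
  rw [map_add, map_sum, map_sum]
  simp only [map_smul, smul_eq_mul, ip, grad, dotProduct, mul_comm]

theorem ip_add_left (u u' v : (ι → ℝ) × (κ → ℝ)) : ip (u + u') v = ip u v + ip u' v := by
  simp [ip, add_dotProduct]; ring

theorem ip_smul_left (c : ℝ) (u v : (ι → ℝ) × (κ → ℝ)) : ip (c • u) v = c * ip u v := by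
  simp [ip, smul_dotProduct]; ring

theorem ip_sub_left (u u' v : (ι → ℝ) × (κ → ℝ)) : ip (u - u') v = ip u v - ip u' v := by
  simp [ip, sub_dotProduct]; ring

theorem ip_neg_right (u v : (ι → ℝ) × (κ → ℝ)) : ip u (-v) = -ip u v := by
  simp [ip, dotProduct_neg]; ring

theorem prodNorm_neg (v : (ι → ℝ) × (κ → ℝ)) : prodNorm (-v) = prodNorm v := by
  simp [prodNorm, l1]

theorem abs_dotProduct_mulVec_le (M : Matrix ι κ ℝ) {L : ℝ} (hL : ∀ i j, |M i j| ≤ L)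
    (x : ι → ℝ) (y : κ → ℝ) : |x ⬝ᵥ M *ᵥ y| ≤ L * (l1 x * l1 y) := by
  have h : L * (l1 x * l1 y) = ∑ i, ∑ j, |x i| * (L * |y j|) := by
    simp only [l1, ← Finset.mul_sum, ← Finset.sum_mul]
    ring
  rw [h, dotProduct]
  refine (Finset.abs_sum_le_sum_abs _ _).trans (Finset.sum_le_sum fun i _ => ?_)
  rw [abs_mul, ← Finset.mul_sum]
  refine mul_le_mul_of_nonneg_left ((Finset.abs_sum_le_sum_abs _ _).trans
    (Finset.sum_le_sum fun j _ => ?_)) (abs_nonneg _)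
  rw [abs_mul]
  exact mul_le_mul_of_nonneg_right (hL i j) (abs_nonneg _)

end Product

noncomputable section

/-! ## Records, paths, and induction over sequences -/

section Records

variable {H : Fin 2 → Type*} {Act : ∀ i, H i → Type*}

theorem GameTree.Occurs.exists_of_cons {T S : GameTree Act}
    {l : ∀ i, List (Σ h : H i, Act i h)} (hS : T.Occurs S l) (i : Fin 2) :
    ∀ (q : Σ h : H i, Act i h) (L : List (Σ h : H i, Act i h)), l i = q :: L →
      ∃ (c : Act i q.1 → GameTree Act) (l' : ∀ i, List (Σ h : H i, Act i h)),
        T.Occurs (.node i q.1 c) l' ∧ l' i = L := by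
  induction hS with
  | root => intro q L h; simp at h
  | chance j _ ih => exact ih
  | @node k h c l a hocc ih =>
    intro q L hq
    by_cases hk : i = k
    · subst hk
      rw [Function.update_self] at hq
      obtain ⟨rfl, rfl⟩ := List.cons.inj hq
      exact ⟨c, l, hocc, rfl⟩
    · rw [Function.update_of_ne hk] at hq
      exact ih q L hq

namespace ZeroSumEFG

variable (G : ZeroSumEFG Act) {i : Fin 2}

theorem record_eq {h : H i} {c : Act i h → GameTree Act} {l : ∀ i, List (Σ h : H i, Act i h)}
    (hocc : G.tree.Occurs (.node i h c) l) : l i = G.record i h := by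
  obtain ⟨c', hc'⟩ := (G.infoset_nonempty i h).choose_spec
  exact G.perfect_recall i h c c' l _ hocc hc'

/-- Some node of `q.1` lies above a node of `h` with record `L`; perfect recall makes `L` the record
of every node of `q.1`. So the decision points of a player form a forest, which permits induction
along parent sequences. -/
theorem record_of_record_eq_cons {h : H i} {q : Σ h : H i, Act i h}
    {L : List (Σ h : H i, Act i h)} (hq : G.record i h = q :: L) : G.record i q.1 = L := by
  obtain ⟨c', hc'⟩ := (G.infoset_nonempty i h).choose_spec
  obtain ⟨c, l, hocc, hl⟩ := hc'.exists_of_cons i q L hq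
  rw [← hl, G.record_eq hocc]

/-- The list of own decisions up to and including a sequence, the most recent one first. -/
def path : Sequence Act i → List (Σ h : H i, Act i h)
  | none => []
  | some q => q :: G.record i q.1

theorem path_parent (h : H i) : G.path (G.parent i h) = G.record i h := by
  cases hr : G.record i h with
  | nil => simp [parent, hr, path]
  | cons q L => simp [parent, hr, path, G.record_of_record_eq_cons hr]

theorem seqInduction {P : Sequence Act i → Prop} (root : P none)
    (step : ∀ (h : H i) (a : Act i h), P (G.parent i h) → P (some ⟨h, a⟩)) (s : Sequence Act i) :
    P s := by
  induction hn : (G.path s).length generalizing s with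
  | zero =>
    cases s with
    | none => exact root
    | some q => simp [path] at hn
  | succ n ih =>
    cases s with
    | none => exact root
    | some q =>
      obtain ⟨h, a⟩ := q
      refine step h a (ih _ ?_)
      rw [path_parent]
      simpa [path] using hn

/-- Record lengths strictly decrease towards the root, so no decision point repeats on a path. -/
theorem record_length_lt (L : List (Σ h : H i, Act i h)) :
    ∀ h : H i, G.record i h = L → ∀ q ∈ L, (G.record i q.1).length < L.length := by
  induction L with
  | nil => intro h _ q hq; simp at hq
  | cons q L ih =>
    intro h hL q' hq'
    have hr := G.record_of_record_eq_cons hL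
    rcases List.mem_cons.1 hq' with rfl | hq'
    · simp [hr]
    · exact (ih q.1 hr q' hq').trans (by simp)

theorem nodup_path (s : Sequence Act i) : ((G.path s).map Sigma.fst).Nodup := by
  refine G.seqInduction (P := fun s => ((G.path s).map Sigma.fst).Nodup)
    (by simp [path]) (fun h a ih => ?_) s
  rw [path_parent] at ih
  refine List.nodup_cons.2 ⟨fun hmem => ?_, ih⟩
  obtain ⟨q, hq, hqh⟩ := List.mem_map.1 hmem
  have := G.record_length_lt _ h rfl q hq
  rw [hqh] at this
  exact lt_irrefl _ this

theorem infoset_induction {P : H i → Prop}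
    (step : ∀ h, (∀ q, G.parent i h = some q → P q.1) → P h) (h : H i) : P h := by
  induction hn : (G.record i h).length using Nat.strong_induction_on generalizing h with
  | _ n ih =>
    refine step h fun q hq => ?_
    obtain ⟨L, hL⟩ := List.head?_eq_some_iff.1 hq
    refine ih _ ?_ q.1 rfl
    rw [← hn, hL, G.record_of_record_eq_cons hL]
    simp

theorem sequenceForm_eq (π : ∀ h : H i, Act i h → ℝ) (s : Sequence Act i) :
    G.sequenceForm π s = ((G.path s).map fun q => π q.1 q.2).prod := by
  cases s with
  | none => simp [path, sequenceForm]
  | some q => obtain ⟨h, a⟩ := q; simp [path, sequenceForm, mul_comm]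

theorem sequenceForm_some (π : ∀ h : H i, Act i h → ℝ) (h : H i) (a : Act i h) :
    G.sequenceForm π (some ⟨h, a⟩) = G.sequenceForm π (G.parent i h) * π h a := by
  rw [G.sequenceForm_eq _ (G.parent i h), path_parent]
  rfl

/-! ## Plans -/

variable {G}

/-- Whether a plan is defined at `h₀` depends only on its choices at earlier decision points, so by
induction the domains coincide. -/
theorem Plan.ext_of_agree {σ σ' : G.Plan i}
    (h : ∀ h a b, σ.1 h = some a → σ'.1 h = some b → a = b) : σ = σ' := by
  refine Subtype.ext (funext fun h₀ => ?_)
  induction h₀ using G.infoset_induction with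
  | _ h₀ ih =>
    have hp : Plays σ.1 (G.parent i h₀) ↔ Plays σ'.1 (G.parent i h₀) := by
      cases hq : G.parent i h₀ with
      | none => rfl
      | some q => obtain ⟨h', a'⟩ := q; simp only [Plays, ih _ hq]
    have hs : (σ.1 h₀).isSome ↔ (σ'.1 h₀).isSome := by rw [σ.2, σ'.2, hp]
    cases h1 : σ.1 h₀ with
    | none =>
      cases h2 : σ'.1 h₀ with
      | none => rfl
      | some b => simp [h1, h2] at hs
    | some a =>
      cases h2 : σ'.1 h₀ with
      | none => simp [h1, h2] at hs
      | some b => rw [h h₀ a b h1 h2]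

variable (G)

open Classical in
/-- The plan obtained from a full pure strategy by forgetting the choices at excluded decision
points. -/
def reduce (τ : ∀ h : H i, Act i h) : G.Plan i :=
  ⟨fun h => if ∀ q ∈ G.record i h, τ q.1 = q.2 then some (τ h) else none, fun h => by
    have key : ∀ s : Sequence Act i,
        Plays (fun h => if ∀ q ∈ G.record i h, τ q.1 = q.2 then some (τ h) else none) s ↔
          ∀ q ∈ G.path s, τ q.1 = q.2 := by
      rintro (_ | ⟨h, a⟩)
      · simp [Plays, path]
      · simp [Plays, path, and_comm]
    rw [key, path_parent]
    by_cases hc : ∀ q ∈ G.record i h, τ q.1 = q.2 <;> simp [hc]⟩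

theorem plays_reduce (τ : ∀ h : H i, Act i h) (s : Sequence Act i) :
    Plays (G.reduce τ).1 s ↔ ∀ q ∈ G.path s, τ q.1 = q.2 := by
  rcases s with _ | ⟨h, a⟩
  · simp [Plays, path]
  · simp [Plays, path, reduce, and_comm]

/-- The fibres of `reduce` are thus product sets, whose mass under independent draws factorizes. -/
theorem reduce_eq_iff (τ : ∀ h : H i, Act i h) (σ : G.Plan i) :
    G.reduce τ = σ ↔ ∀ h, ∀ a ∈ σ.1 h, τ h = a := by
  have hτ : ∀ h a, (G.reduce τ).1 h = some a → τ h = a := by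
    intro h a ha
    simp only [reduce] at ha
    split_ifs at ha
    exact Option.some.inj ha
  constructor
  · rintro rfl h a ha
    exact hτ h a ha
  · intro h
    exact Plan.ext_of_agree fun h' a b ha hb => (hτ h' a ha).symm.trans (h h' b hb)

instance [∀ h, Nonempty (Act i h)] : Nonempty (G.Plan i) :=
  ⟨G.reduce fun _ => Classical.arbitrary _⟩

end ZeroSumEFG

end Records

/-! ## Realization of mixtures -/

section Mixtures

variable {H : Fin 2 → Type*} {Act : ∀ i, H i → Type*}
  [∀ i, Fintype (H i)] [∀ i, DecidableEq (H i)]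
  [∀ i h, Fintype (Act i h)] [∀ i h, DecidableEq (Act i h)]

open Classical in
theorem sum_prod_of_forall {K : Type*} {B : K → Type*} [Fintype K] [DecidableEq K]
    [∀ k, Fintype (B k)] (C : ∀ k, B k → Prop) (π : ∀ k, B k → ℝ) :
    (∑ τ : (∀ k, B k), if ∀ k, C k (τ k) then ∏ k, π k (τ k) else 0)
      = ∏ k, ∑ a, if C k a then π k a else 0 := by
  rw [Fintype.prod_sum]
  refine Finset.sum_congr rfl fun τ _ => ?_
  rw [Finset.prod_ite_zero]
  simp

-- Induction on `L`: a listed coordinate contributes its prescribed probability, an unlisted one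
-- contributes `1`. Distinctness of the coordinates prevents conflicting constraints.
open Classical in
theorem prod_sum_of_nodup {K : Type*} {B : K → Type*} [Fintype K] [DecidableEq K]
    [∀ k, Fintype (B k)] (π : ∀ k, B k → ℝ) (hπ : ∀ k, ∑ a, π k a = 1)
    (L : List (Σ k, B k)) (hL : (L.map Sigma.fst).Nodup) :
    ∀ C : ∀ k, B k → Prop, (∀ k a, C k a ↔ ∀ b, (⟨k, b⟩ : Σ k, B k) ∈ L → a = b) →
    ∏ k, ∑ a, (if C k a then π k a else 0) = (L.map fun q => π q.1 q.2).prod := by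
  induction L with
  | nil => intro C hC; simp [hC, hπ]
  | cons q L ih =>
    intro C hC
    obtain ⟨k₀, b₀⟩ := q
    simp only [List.map_cons, List.nodup_cons] at hL
    obtain ⟨C', hC'⟩ : ∃ C' : ∀ k, B k → Prop,
        ∀ k a, C' k a ↔ ∀ b, (⟨k, b⟩ : Σ k, B k) ∈ L → a = b := ⟨_, fun _ _ => Iff.rfl⟩
    rw [List.map_cons, List.prod_cons, ← ih hL.2 C' hC']
    have hnot : ∀ b, (⟨k₀, b⟩ : Σ k, B k) ∉ L := fun b hb =>
      hL.1 (List.mem_map.2 ⟨_, hb, rfl⟩)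
    rw [← Finset.mul_prod_erase _ _ (Finset.mem_univ k₀),
      ← Finset.mul_prod_erase Finset.univ (fun k => ∑ a, if C' k a then π k a else 0) (Finset.mem_univ k₀)]
    have h1 : (∑ a, if C k₀ a then π k₀ a else 0) = π k₀ b₀ := by
      simp [hC, hnot]
    have h2 : (∑ a, if C' k₀ a then π k₀ a else 0) = 1 := by
      simp [hC', hnot, hπ]
    rw [h1, h2, one_mul]
    congr 1
    refine Finset.prod_congr rfl fun k hk => Finset.sum_congr rfl fun a _ => ?_
    have hk' : k ≠ k₀ := (Finset.mem_erase.1 hk).1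
    simp [hC, hC', hk']

namespace ZeroSumEFG

variable (G : ZeroSumEFG Act) {i : Fin 2}

-- The mixture is the image under `reduce` of the product distribution on full pure strategies.
open Classical in
theorem mixture_eq_sum (π : ∀ h : H i, Act i h → ℝ) (hπ : ∀ h, π h ∈ stdSimplex ℝ (Act i h))
    (σ : G.Plan i) :
    G.mixture π σ = ∑ τ : (∀ h, Act i h), if G.reduce τ = σ then ∏ h, π h (τ h) else 0 := by
  refine Eq.trans ?_ ((sum_prod_of_forall (fun h b => ∀ a ∈ σ.1 h, b = a) π).symm.trans
    (Finset.sum_congr rfl fun τ _ => ?_))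
  swap
  · by_cases hc : G.reduce τ = σ
    · rw [if_pos hc, if_pos ((G.reduce_eq_iff τ σ).1 hc)]
    · rw [if_neg hc, if_neg (mt (G.reduce_eq_iff τ σ).2 hc)]
  refine Finset.prod_congr rfl fun h _ => ?_
  cases hσ : σ.1 h with
  | none => simp [(hπ h).2]
  | some a => simp

theorem mixture_nonneg (π : ∀ h : H i, Act i h → ℝ) (hπ : ∀ h, π h ∈ stdSimplex ℝ (Act i h))
    (σ : G.Plan i) : 0 ≤ G.mixture π σ :=
  Finset.prod_nonneg fun h _ => by
    cases σ.1 h with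
    | none => simp
    | some a => exact (hπ h).1 a

theorem mixture_pos (π : ∀ h : H i, Act i h → ℝ) (hπ : ∀ h a, 0 < π h a)
    (σ : G.Plan i) : 0 < G.mixture π σ :=
  Finset.prod_pos fun h _ => by
    cases σ.1 h with
    | none => simp
    | some a => exact hπ h a

/-- Both sides are the probability that independently drawn actions follow `G.path s`. -/
theorem realization_mixture (π : ∀ h : H i, Act i h → ℝ)
    (hπ : ∀ h, π h ∈ stdSimplex ℝ (Act i h)) :
    G.realization (G.mixture π) = G.sequenceForm π := by
  classical
  funext s
  rw [sequenceForm_eq, ← prod_sum_of_nodup π (fun h => (hπ h).2) _ (G.nodup_path s)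
      (fun h a => ∀ b, (⟨h, b⟩ : Σ h, Act i h) ∈ G.path s → a = b) fun _ _ => Iff.rfl,
    ← sum_prod_of_forall]
  simp only [realization, G.mixture_eq_sum π hπ]
  have h1 : ∀ σ : G.Plan i, (if Plays σ.1 s then
      ∑ τ : (∀ h, Act i h), if G.reduce τ = σ then ∏ h, π h (τ h) else 0 else 0)
      = ∑ τ : (∀ h, Act i h), if G.reduce τ = σ then
          (if Plays (G.reduce τ).1 s then ∏ h, π h (τ h) else 0) else 0 := by
    intro σ
    split_ifs with hσ
    · refine Finset.sum_congr rfl fun τ _ => ?_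
      by_cases hτ : G.reduce τ = σ
      · subst hτ; simp [hσ]
      · simp [hτ]
    · symm
      refine Finset.sum_eq_zero fun τ _ => ?_
      by_cases hτ : G.reduce τ = σ
      · subst hτ; simp [hσ]
      · simp [hτ]
  rw [Finset.sum_congr rfl fun σ _ => h1 σ, Finset.sum_comm]
  refine Finset.sum_congr rfl fun τ _ => ?_
  rw [Finset.sum_ite_eq]
  simp [plays_reduce, Sigma.forall]

theorem mixture_mem_stdSimplex (π : ∀ h : H i, Act i h → ℝ)
    (hπ : ∀ h, π h ∈ stdSimplex ℝ (Act i h)) : G.mixture π ∈ stdSimplex ℝ (G.Plan i) := by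
  refine ⟨G.mixture_nonneg π hπ, ?_⟩
  -- The empty sequence is always played, so its realization is the total mass.
  have := congrFun (G.realization_mixture π hπ) none
  simpa [realization, Plays, sequenceForm] using this

/-! ## The sequence-form polytope -/

open Classical in
/-- The sequence-form vector of a plan. -/
def planVector (σ : G.Plan i) (s : Sequence Act i) : ℝ := if Plays σ.1 s then 1 else 0

theorem realization_eq (q : G.Plan i → ℝ) (s : Sequence Act i) :
    G.realization q s = ∑ σ, q σ * G.planVector σ s := by
  simp [realization, planVector]

theorem dotProduct_realization (c : Sequence Act i → ℝ) (q : G.Plan i → ℝ) :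
    c ⬝ᵥ G.realization q = ∑ σ, q σ * (c ⬝ᵥ G.planVector σ) := by
  simp only [dotProduct, realization_eq, Finset.mul_sum]
  rw [Finset.sum_comm]
  exact Finset.sum_congr rfl fun σ _ => Finset.sum_congr rfl fun s _ => by ring

theorem planVector_mem (σ : G.Plan i) : G.planVector σ ∈ G.polytope i := by
  classical
  refine ⟨fun s => ?_, by simp [planVector, Plays], fun h => ?_⟩
  · unfold planVector; split_ifs <;> norm_num
  · have := σ.2 h
    cases hσ : σ.1 h with
    | none =>
      rw [hσ] at this
      simp only [Option.isSome_none, Bool.false_eq_true, false_iff] at this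
      rw [show G.planVector σ (G.parent i h) = 0 from if_neg this]
      simp [planVector, Plays, hσ]
    | some a =>
      rw [hσ] at this
      simp only [Option.isSome_some, true_iff] at this
      rw [show G.planVector σ (G.parent i h) = 1 from if_pos this]
      simp [planVector, Plays, hσ]

theorem realization_mem {q : G.Plan i → ℝ} (hq : q ∈ stdSimplex ℝ (G.Plan i)) :
    G.realization q ∈ G.polytope i := by
  refine ⟨fun s => ?_, ?_, fun h => ?_⟩
  · rw [realization_eq]
    exact Finset.sum_nonneg fun σ _ => mul_nonneg (hq.1 σ) ((G.planVector_mem σ).1 s)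
  · simp only [realization_eq, (G.planVector_mem _).2.1, mul_one, hq.2]
  · simp only [realization_eq]
    rw [Finset.sum_comm]
    simp only [← Finset.mul_sum, (G.planVector_mem _).2.2 h]

variable {G}

theorem le_one_of_mem_polytope {x : Sequence Act i → ℝ} (hx : x ∈ G.polytope i)
    (s : Sequence Act i) : x s ≤ 1 := by
  refine G.seqInduction (P := fun s => x s ≤ 1) hx.2.1.le (fun h a ih => le_trans ?_ ih) s
  rw [← hx.2.2 h]
  exact Finset.single_le_sum (f := fun a => x (some ⟨h, a⟩)) (fun _ _ => hx.1 _)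
    (Finset.mem_univ a)

theorem sequenceForm_eq_of_forall {x : Sequence Act i → ℝ} (hx : x none = 1)
    {π : ∀ h : H i, Act i h → ℝ} (h : ∀ h a, x (some ⟨h, a⟩) = x (G.parent i h) * π h a) :
    G.sequenceForm π = x :=
  funext fun s => G.seqInduction (P := fun s => G.sequenceForm π s = x s)
    (by simp [sequenceForm, hx]) (fun h' a ih => by rw [sequenceForm_some, ih, h]) s

theorem exists_policy [∀ h, Nonempty (Act i h)] {x : Sequence Act i → ℝ}
    (hx : x ∈ G.polytope i) :
    ∃ π : ∀ h : H i, Act i h → ℝ, (∀ h, π h ∈ stdSimplex ℝ (Act i h)) ∧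
      ∀ h a, x (some ⟨h, a⟩) = x (G.parent i h) * π h a := by
  have : ∀ h : H i, ∃ p ∈ stdSimplex ℝ (Act i h),
      ∀ a, x (some ⟨h, a⟩) = x (G.parent i h) * p a := by
    intro h
    rcases (hx.1 (G.parent i h)).eq_or_lt with h0 | hpos
    -- At an unreached decision point every local distribution works.
    · refine ⟨Pi.single (Classical.arbitrary _) 1, single_mem_stdSimplex _ _, fun a => ?_⟩
      have h1 := hx.2.2 h
      rw [← h0, Finset.sum_eq_zero_iff_of_nonneg fun _ _ => hx.1 _] at h1
      rw [h1 a (Finset.mem_univ a), ← h0, zero_mul]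
    · refine ⟨fun a => x (some ⟨h, a⟩) / x (G.parent i h),
        ⟨fun a => div_nonneg (hx.1 _) (hx.1 _), ?_⟩, fun a => ?_⟩
      · rw [← Finset.sum_div, hx.2.2 h, div_self hpos.ne']
      · field_simp
  choose π h1 h2 using this
  exact ⟨π, h1, h2⟩

/-- Every point of the sequence-form polytope is the realization of a mixture. -/
theorem exists_realization_eq [∀ h, Nonempty (Act i h)] {x : Sequence Act i → ℝ}
    (hx : x ∈ G.polytope i) : ∃ q ∈ stdSimplex ℝ (G.Plan i), G.realization q = x := by
  obtain ⟨π, h1, h2⟩ := exists_policy hx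
  exact ⟨G.mixture π, G.mixture_mem_stdSimplex π h1,
    (G.realization_mixture π h1).trans (sequenceForm_eq_of_forall hx.2.1 h2)⟩

/-- The uniform policy realizes every sequence with positive probability, so some plan plays it. -/
theorem exists_planVector_pos [∀ h, Nonempty (Act i h)] (s : Sequence Act i) :
    ∃ σ : G.Plan i, 0 < G.planVector σ s := by
  set π : ∀ h : H i, Act i h → ℝ := fun h _ => (Fintype.card (Act i h) : ℝ)⁻¹
  have hpos : ∀ h a, 0 < π h a := fun h a => inv_pos.2 (Nat.cast_pos.2 Fintype.card_pos)
  have hπ : ∀ h, π h ∈ stdSimplex ℝ (Act i h) := fun h =>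
    ⟨fun a => (hpos h a).le, by simp [π]⟩
  have h1 : 0 < G.realization (G.mixture π) s := by
    rw [G.realization_mixture π hπ, sequenceForm_eq]
    refine List.prod_pos fun y hy => ?_
    obtain ⟨q, _, rfl⟩ := List.mem_map.1 hy
    exact hpos q.1 q.2
  rw [realization_eq] at h1
  obtain ⟨σ, _, hσ⟩ := Finset.exists_lt_of_sum_lt (f := fun _ => (0 : ℝ)) (by simpa using h1)
  exact ⟨σ, pos_of_mul_pos_right hσ (G.mixture_nonneg π hπ σ)⟩

theorem realization_pos [∀ h, Nonempty (Act i h)] {q : G.Plan i → ℝ} (hq : ∀ σ, 0 < q σ)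
    (s : Sequence Act i) : 0 < G.realization q s := by
  obtain ⟨σ, hσ⟩ := exists_planVector_pos (G := G) s
  rw [realization_eq]
  exact Finset.sum_pos' (fun σ _ => mul_nonneg (hq σ).le ((G.planVector_mem σ).1 s))
    ⟨σ, Finset.mem_univ σ, mul_pos (hq σ) hσ⟩

end ZeroSumEFG

end Mixtures

section Payoffs

variable {H : Fin 2 → Type*} {Act : ∀ i, H i → Type*}
  [∀ i, Fintype (H i)] [∀ i, DecidableEq (H i)]
  [∀ i h, Fintype (Act i h)] [∀ i h, DecidableEq (Act i h)]

namespace ZeroSumEFG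

variable (G : ZeroSumEFG Act)

/-! ## Expected payoffs -/

theorem planVector_some {i : Fin 2} (σ : G.Plan i) (h : H i) (a : Act i h) :
    G.planVector σ (some ⟨h, a⟩) = if σ.1 h = some a then 1 else 0 := by
  simp only [planVector, Plays]
  congr

/-- The factor in front of the payoff tells whether the plans lead to the subtree. Tracking it makes
the tree induction go through, and the root, with factor `1`, is the case of interest. -/
theorem planVector_dotProduct_payoffMatrix (σ : ∀ i, G.Plan i) (T : GameTree Act) :
    ∀ l : (∀ i, List (Σ h : H i, Act i h)), G.tree.Occurs T l →
      G.planVector (σ 0) ⬝ᵥ T.payoffMatrix (fun i => (l i).head?) *ᵥ G.planVector (σ 1)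
        = (∏ i, G.planVector (σ i) (l i).head?) * T.payoff (fun i => (σ i).1) := by
  induction T with
  | leaf u =>
    intro l _
    simp only [GameTree.payoffMatrix, GameTree.payoff, Fin.prod_univ_two]
    rw [Matrix.single_mulVec]
    change G.planVector (σ 0) ⬝ᵥ Pi.single (l 0).head? _ = _
    rw [dotProduct_single]
    ring
  | chance k p c ih =>
    intro l hl
    simp only [GameTree.payoffMatrix, GameTree.payoff, Matrix.sum_mulVec, dotProduct_sum,
      Matrix.smul_mulVec, dotProduct_smul, smul_eq_mul, Finset.mul_sum]
    refine Finset.sum_congr rfl fun j _ => ?_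
    rw [ih j l (.chance j hl)]
    ring
  | node i h c ih =>
    intro l hl
    have hseq : ∀ a, Function.update (fun k => (l k).head?) i (some ⟨h, a⟩)
        = fun k => (Function.update l i (⟨h, a⟩ :: l i) k).head? := by
      intro a
      funext k
      by_cases hk : k = i
      · subst hk; simp
      · simp [Function.update_of_ne hk]
    simp only [GameTree.payoffMatrix, GameTree.payoff, Matrix.sum_mulVec, dotProduct_sum, hseq]
    rw [Finset.sum_congr rfl fun a _ => ih a _ (.node a hl)]
    have hsplit : ∀ a, ∏ k, G.planVector (σ k) (Function.update l i (⟨h, a⟩ :: l i) k).head?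
        = G.planVector (σ i) (some ⟨h, a⟩)
          * ∏ k ∈ Finset.univ.erase i, G.planVector (σ k) (l k).head? := by
      intro a
      rw [← Finset.mul_prod_erase _ _ (Finset.mem_univ i), Function.update_self]
      congr 1
      refine Finset.prod_congr rfl fun k hk => ?_
      rw [Function.update_of_ne (Finset.mem_erase.1 hk).1]
    have hparent : (l i).head? = G.parent i h := by rw [G.record_eq hl]; rfl
    have hsum := (G.planVector_mem (σ i)).2.2 h
    rw [← Finset.mul_prod_erase _ (fun k => G.planVector (σ k) (l k).head?)
      (Finset.mem_univ i), hparent, ← hsum]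
    simp only [hsplit, planVector_some]
    -- If the plan is undefined at `h`, the flow constraint makes the factor vanish, so the default
    -- payoff `0` is harmless.
    cases hσ : (σ i).1 h with
    | none => simp
    | some a => simp

theorem value_eq (m : ∀ i, G.Plan i → ℝ) :
    G.value m = G.realization (m 0) ⬝ᵥ G.A *ᵥ G.realization (m 1) := by
  have h1 : G.value m = ∑ σ₀, ∑ σ₁, m 0 σ₀ * m 1 σ₁ *
      (G.planVector σ₀ ⬝ᵥ G.A *ᵥ G.planVector σ₁) := by
    rw [value, ← Fintype.sum_prod_type']
    refine Fintype.sum_equiv (piFinTwoEquiv G.Plan) _ _ fun σ => ?_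
    have h := G.planVector_dotProduct_payoffMatrix σ G.tree _ .root
    simp only [List.head?_nil, (G.planVector_mem _).2.1, Finset.prod_const_one, one_mul] at h
    rw [← h, Fin.prod_univ_two]
    rfl
  rw [h1, dotProduct_comm, dotProduct_realization]
  refine Finset.sum_congr rfl fun σ₀ _ => ?_
  rw [dotProduct_comm, Matrix.dotProduct_mulVec, dotProduct_realization, Finset.mul_sum]
  refine Finset.sum_congr rfl fun σ₁ _ => ?_
  rw [← Matrix.dotProduct_mulVec, mul_assoc]

/-! ### Equilibria as pairs of logit responses -/

/-- The logit best responses of player `i` to the linear cost `c` on sequences: the mixed strategies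
proportional to `exp (-⟨c, ·⟩ / α)`. -/
def IsLogit {i : Fin 2} (c : Sequence Act i → ℝ) (α : ℝ) (q : G.Plan i → ℝ) : Prop :=
  q ∈ stdSimplex ℝ (G.Plan i) ∧ (∀ σ, 0 < q σ) ∧
    ∃ k, ∀ σ, -(c ⬝ᵥ G.planVector σ) - α * Real.log (q σ) = k

theorem isLogit_iff [∀ i h, Nonempty (Act i h)] {i : Fin 2} (c : Sequence Act i → ℝ) {α : ℝ}
    (hα : 0 < α) (q : G.Plan i → ℝ) :
    G.IsLogit c α q ↔ q ∈ stdSimplex ℝ (G.Plan i) ∧ ∀ q' ∈ stdSimplex ℝ (G.Plan i),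
      -(c ⬝ᵥ G.realization q') + α * G.entropy q' ≤ -(c ⬝ᵥ G.realization q) + α * G.entropy q := by
  refine and_congr_right fun hq => ?_
  rw [← isMax_entropy_iff _ hα hq]
  simp only [dotProduct_realization, entropy, mul_neg, Finset.sum_neg_distrib]

theorem isQRE_iff [∀ i h, Nonempty (Act i h)] {α : ℝ} (hα : 0 < α) (m : ∀ i, G.Plan i → ℝ) :
    G.IsQRE α m ↔ G.IsLogit (G.F (G.realizationPair m)).1 α (m 0) ∧
      G.IsLogit (G.F (G.realizationPair m)).2 α (m 1) := by
  rw [isLogit_iff G _ hα, isLogit_iff G _ hα, IsQRE, Fin.forall_fin_two]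
  have h0 : ∀ q, G.reward 0 (Function.update m 0 q)
      = -((G.F (G.realizationPair m)).1 ⬝ᵥ G.realization q) := by
    intro q
    rw [reward, if_pos rfl, value_eq, Function.update_self,
      Function.update_of_ne (by decide), dotProduct_comm]
    rfl
  have h1 : ∀ q, G.reward 1 (Function.update m 1 q)
      = -((G.F (G.realizationPair m)).2 ⬝ᵥ G.realization q) := by
    intro q
    rw [reward, if_neg (by decide), value_eq, Function.update_self,
      Function.update_of_ne (by decide), Matrix.dotProduct_mulVec, ← Matrix.mulVec_transpose]
    simp [F, realizationPair]
  have h0' := h0 (m 0)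
  have h1' := h1 (m 1)
  rw [Function.update_eq_self] at h0' h1'
  simp only [h0, h1, h0', h1']

/-! ## The derivative of the dilated entropy -/

variable {G} {i : Fin 2}

variable (G) in
/-- The policy of a sequence-form strategy. -/
def ratio (x : Sequence Act i → ℝ) (h : H i) (a : Act i h) : ℝ :=
  x (some ⟨h, a⟩) / x (G.parent i h)

variable (G) in
/-- The derivative of the dilated entropy at `x` in the direction `v`. -/
def entropyDeriv (x v : Sequence Act i → ℝ) : ℝ :=
  ∑ h : H i, ∑ a, (v (some ⟨h, a⟩) * (Real.log (G.ratio x h a) + 1)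
    - v (G.parent i h) * G.ratio x h a)

variable (G i) in
/-- The vectors which are positive at all sequences on which the dilated entropy depends. -/
def posDom : Set (Sequence Act i → ℝ) :=
  {x | ∀ (h : H i) (a : Act i h), 0 < x (G.parent i h) ∧ 0 < x (some ⟨h, a⟩)}

theorem isOpen_posDom : IsOpen (G.posDom i) := by
  simp only [posDom, Set.ofPred_forall, Set.ofPred_and]
  exact isOpen_iInter_of_finite fun h => isOpen_iInter_of_finite fun a =>
    (isOpen_lt continuous_const (continuous_apply _)).inter
      (isOpen_lt continuous_const (continuous_apply _))

theorem interior_entropyDom : interior (G.entropyDom i) = G.posDom i := by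
  have key : ∀ s : Sequence Act i, ∀ x ∈ interior {x : Sequence Act i → ℝ | 0 ≤ x s}, 0 < x s := by
    intro s x hx
    -- Evaluation at `s` is open and continuous, so taking interiors commutes with its preimage.
    have h := (isOpenMap_eval (X := fun _ : Sequence Act i => ℝ)
      s).preimage_interior_eq_interior_preimage (continuous_apply s) (Set.Ici 0)
    rw [interior_Ici] at h
    exact h.symm.subset hx
  refine Set.Subset.antisymm (fun x hx h a => ⟨key _ x ?_, key _ x ?_⟩)
    (interior_maximal (fun x hx h a => ⟨(hx h a).1.le, (hx h a).2.le, fun h0 =>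
      absurd h0 (hx h a).1.ne'⟩) isOpen_posDom)
  · exact interior_mono (fun y hy => (hy h a).1) hx
  · exact interior_mono (fun y hy => (hy h a).2.1) hx

theorem intDom_eq : G.intDom = G.posDom 0 ×ˢ G.posDom 1 := by
  rw [intDom, interior_prod_eq, interior_entropyDom, interior_entropyDom]

theorem differentiableAt_dilatedEntropy {x : Sequence Act i → ℝ} (hx : x ∈ G.posDom i) :
    DifferentiableAt ℝ (G.dilatedEntropy i) x := by
  unfold dilatedEntropy
  refine DifferentiableAt.fun_sum fun h _ => ?_
  refine (differentiableAt_apply _ _).mul (DifferentiableAt.fun_sum fun a _ => ?_)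
  have h1 := hx h a
  have h2 : DifferentiableAt ℝ
      (fun x : Sequence Act i → ℝ => x (some ⟨h, a⟩) / x (G.parent i h)) x := by
    simp only [div_eq_mul_inv]
    exact (differentiableAt_apply _ _).mul ((differentiableAt_apply _ _).fun_inv h1.1.ne')
  exact h2.mul (h2.log (div_pos h1.2 h1.1).ne')

theorem hasDerivAt_dilatedEntropy {x : Sequence Act i → ℝ} (hx : x ∈ G.posDom i)
    (v : Sequence Act i → ℝ) :
    HasDerivAt (fun t : ℝ => G.dilatedEntropy i (x + t • v)) (G.entropyDeriv x v) 0 := by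
  unfold dilatedEntropy entropyDeriv
  refine HasDerivAt.fun_sum fun h _ => ?_
  simp only [Finset.mul_sum]
  refine HasDerivAt.fun_sum fun a _ => ?_
  have hlin : ∀ s, HasDerivAt (fun t : ℝ => (x + t • v) s) (v s) 0 := by
    intro s
    simpa using ((hasDerivAt_id (0 : ℝ)).mul_const (v s)).const_add (x s)
  obtain ⟨hp, ha⟩ := hx h a
  have hu := (hlin (some ⟨h, a⟩)).fun_div (hlin (G.parent i h)) (by simpa using hp.ne')
  have hl := hu.log (by simpa using (div_pos ha hp).ne')
  -- With `w` the parent coordinate and `u` the ratio, `w u' = v (some ⟨h, a⟩) - v (G.parent i h) *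
  -- u`.
  refine ((hlin (G.parent i h)).mul (hu.mul hl)).congr_deriv ?_
  simp only [ratio, zero_smul, add_zero, Pi.mul_apply]
  field_simp
  ring

theorem differentiableAt_psi {z : (Sequence Act 0 → ℝ) × (Sequence Act 1 → ℝ)}
    (hz : z ∈ G.intDom) : DifferentiableAt ℝ G.psi z := by
  rw [intDom_eq] at hz
  exact ((differentiableAt_dilatedEntropy hz.1).comp z differentiableAt_fst).add
    ((differentiableAt_dilatedEntropy hz.2).comp z differentiableAt_snd)

theorem ip_grad_psi {z : (Sequence Act 0 → ℝ) × (Sequence Act 1 → ℝ)}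
    (hz : z ∈ G.intDom) (v : (Sequence Act 0 → ℝ) × (Sequence Act 1 → ℝ)) :
    ip (grad G.psi z) v = G.entropyDeriv z.1 v.1 + G.entropyDeriv z.2 v.2 := by
  rw [ip_grad, ← (differentiableAt_psi hz).lineDeriv_eq_fderiv]
  rw [intDom_eq] at hz
  exact HasLineDerivAt.lineDeriv
    ((hasDerivAt_dilatedEntropy hz.1 v.1).add (hasDerivAt_dilatedEntropy hz.2 v.2))

theorem entropyDeriv_sub (x u v : Sequence Act i → ℝ) :
    G.entropyDeriv x (u - v) = G.entropyDeriv x u - G.entropyDeriv x v := by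
  simp only [entropyDeriv, ← Finset.sum_sub_distrib, Pi.sub_apply]
  exact Finset.sum_congr rfl fun h _ => Finset.sum_congr rfl fun a _ => by ring

theorem ratio_pos {x : Sequence Act i → ℝ} (hx : x ∈ G.posDom i) (h : H i) (a : Act i h) :
    0 < G.ratio x h a := div_pos (hx h a).2 (hx h a).1

theorem ratio_mem [∀ i h, Nonempty (Act i h)] {x : Sequence Act i → ℝ} (hx : x ∈ G.polytope i)
    (hx' : x ∈ G.posDom i) (h : H i) : G.ratio x h ∈ stdSimplex ℝ (Act i h) := by
  refine ⟨fun a => (ratio_pos hx' h a).le, ?_⟩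
  simp only [ratio]
  rw [← Finset.sum_div, hx.2.2 h, div_self (hx' h (Classical.arbitrary _)).1.ne']

theorem mul_ratio {x : Sequence Act i → ℝ} (hx : x ∈ G.posDom i) (h : H i) (a : Act i h) :
    x (some ⟨h, a⟩) = x (G.parent i h) * G.ratio x h a :=
  (mul_div_cancel₀ _ (hx h a).1.ne').symm

theorem sequenceForm_ratio {x : Sequence Act i → ℝ} (hx : x ∈ G.polytope i)
    (hx' : x ∈ G.posDom i) : G.sequenceForm (G.ratio x) = x :=
  sequenceForm_eq_of_forall hx.2.1 (mul_ratio hx')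

theorem ratio_sequenceForm {π : ∀ h : H i, Act i h → ℝ}
    (hx : G.sequenceForm π ∈ G.posDom i) : G.ratio (G.sequenceForm π) = π := by
  funext h a
  rw [ratio, sequenceForm_some, mul_div_cancel_left₀ _ (hx h a).1.ne']

/-- The terms without logarithm cancel at each `h`: the children of `v` sum to its parent value and
the ratios of `x` sum to `1`. -/
theorem entropyDeriv_eq [∀ i h, Nonempty (Act i h)] {x v : Sequence Act i → ℝ}
    (hx : x ∈ G.polytope i) (hx' : x ∈ G.posDom i) (hv : v ∈ G.polytope i) :
    G.entropyDeriv x v = ∑ h : H i, ∑ a, v (some ⟨h, a⟩) * Real.log (G.ratio x h a) := by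
  refine Finset.sum_congr rfl fun h _ => ?_
  have h1 := hv.2.2 h
  have h2 := (ratio_mem hx hx' h).2
  simp only [mul_add, mul_one, Finset.sum_sub_distrib, Finset.sum_add_distrib, ← Finset.mul_sum]
  rw [h1, h2]
  ring

/-! ## Logit responses and the variational inequality of one player -/

theorem log_mixture {π : ∀ h : H i, Act i h → ℝ} (hπ : ∀ h a, 0 < π h a) (σ : G.Plan i) :
    Real.log (G.mixture π σ)
      = ∑ h : H i, ∑ a, G.planVector σ (some ⟨h, a⟩) * Real.log (π h a) := by
  rw [mixture, Real.log_prod]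
  · refine Finset.sum_congr rfl fun h _ => ?_
    simp only [planVector_some]
    cases hσ : σ.1 h with
    | none => simp
    | some a => simp
  · intro h _
    cases σ.1 h with
    | none => simp
    | some a => exact (hπ h a).ne'

/-- The cross term `∑ q log p` against a product mixture `p` depends on `q` only through its
realization. -/
theorem entropyDeriv_realization [∀ i h, Nonempty (Act i h)] {x : Sequence Act i → ℝ}
    (hx : x ∈ G.polytope i) (hx' : x ∈ G.posDom i) {q : G.Plan i → ℝ}
    (hq : q ∈ stdSimplex ℝ (G.Plan i)) :
    G.entropyDeriv x (G.realization q)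
      = ∑ σ, q σ * Real.log (G.mixture (G.ratio x) σ) := by
  rw [entropyDeriv_eq hx hx' (G.realization_mem hq)]
  simp only [log_mixture (ratio_pos hx'), realization_eq, Finset.mul_sum, Finset.sum_mul]
  symm
  rw [Finset.sum_comm]
  refine Finset.sum_congr rfl fun h _ => ?_
  rw [Finset.sum_comm]
  exact Finset.sum_congr rfl fun a _ => Finset.sum_congr rfl fun σ _ => by ring

/-- The inequality of player `i` in the variational inequality for the cost vector `c`. -/
def SolvesVI (G : ZeroSumEFG Act) (c : Sequence Act i → ℝ) (α : ℝ) (x : Sequence Act i → ℝ) :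
    Prop :=
  (x ∈ G.polytope i ∧ x ∈ G.posDom i) ∧
    ∀ x' ∈ G.polytope i, 0 ≤ c ⬝ᵥ (x' - x) + α * G.entropyDeriv x (x' - x)

/-- A logit response has full support, hence a positive realization. -/
theorem IsLogit.realization_mem_posDom [∀ i h, Nonempty (Act i h)] {c : Sequence Act i → ℝ}
    {α : ℝ} {q : G.Plan i → ℝ} (hq : G.IsLogit c α q) : G.realization q ∈ G.posDom i :=
  fun _ _ => ⟨realization_pos hq.2.1 _, realization_pos hq.2.1 _⟩

theorem mixture_ratio_mem [∀ i h, Nonempty (Act i h)] {x : Sequence Act i → ℝ}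
    (hx : x ∈ G.polytope i) (hx' : x ∈ G.posDom i) :
    G.mixture (G.ratio x) ∈ stdSimplex ℝ (G.Plan i) :=
  G.mixture_mem_stdSimplex _ (ratio_mem hx hx')

theorem realization_mixture_ratio [∀ i h, Nonempty (Act i h)] {x : Sequence Act i → ℝ}
    (hx : x ∈ G.polytope i) (hx' : x ∈ G.posDom i) :
    G.realization (G.mixture (G.ratio x)) = x :=
  (G.realization_mixture _ (ratio_mem hx hx')).trans (sequenceForm_ratio hx hx')

/-- A logit response draws the actions at the decision points independently. -/
theorem IsLogit.mixture_ratio_realization [∀ i h, Nonempty (Act i h)] {c : Sequence Act i → ℝ}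
    {α : ℝ} (hα : 0 < α) {q : G.Plan i → ℝ} (hq : G.IsLogit c α q) :
    G.mixture (G.ratio (G.realization q)) = q := by
  have hx := G.realization_mem hq.1
  have hx' := hq.realization_mem_posDom
  have hp := mixture_ratio_mem hx hx'
  have hreal := realization_mixture_ratio hx hx'
  symm
  refine eq_of_relativeEntropy_nonpos hq.1 hp (G.mixture_pos _ (ratio_pos hx')) ?_
  -- The mixture has the same realization as `q`, hence the same cost, so only the entropies are
  -- compared.
  have h1 := ((G.isLogit_iff c hα q).1 hq).2 _ hp
  rw [hreal] at h1
  have h2 : G.entropy (G.mixture (G.ratio (G.realization q))) ≤ G.entropy q :=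
    le_of_mul_le_mul_left (by linarith) hα
  have h3 := entropyDeriv_realization hx hx' hq.1
  have h4 := entropyDeriv_realization hx hx' hp
  rw [hreal, h3] at h4
  simp only [entropy, Real.negMulLog, neg_mul, Finset.sum_neg_distrib] at h2
  simp only [mul_sub, Finset.sum_sub_distrib]
  linarith

theorem dotProduct_add_entropyDeriv [∀ i h, Nonempty (Act i h)] (c : Sequence Act i → ℝ) (α : ℝ)
    {x : Sequence Act i → ℝ} (hx : x ∈ G.polytope i) (hx' : x ∈ G.posDom i) {q : G.Plan i → ℝ}
    (hq : q ∈ stdSimplex ℝ (G.Plan i)) :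
    c ⬝ᵥ G.realization q + α * G.entropyDeriv x (G.realization q)
      = ∑ σ, q σ * (c ⬝ᵥ G.planVector σ + α * Real.log (G.mixture (G.ratio x) σ)) := by
  rw [entropyDeriv_realization hx hx' hq, dotProduct_realization, Finset.mul_sum,
    ← Finset.sum_add_distrib]
  exact Finset.sum_congr rfl fun σ _ => by ring

/-- The functional `c + α ∇ψ` at the realization is constant on the polytope, so equality holds
throughout. -/
theorem IsLogit.solvesVI [∀ i h, Nonempty (Act i h)] {c : Sequence Act i → ℝ}
    {α : ℝ} (hα : 0 < α) {q : G.Plan i → ℝ} (hq : G.IsLogit c α q) :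
    G.SolvesVI c α (G.realization q) := by
  have hx := G.realization_mem hq.1
  have hx' := hq.realization_mem_posDom
  refine ⟨⟨hx, hx'⟩, fun x' hmem => ?_⟩
  obtain ⟨q', hq', rfl⟩ := exists_realization_eq hmem
  obtain ⟨k, hk⟩ := hq.2.2
  have key : ∀ p ∈ stdSimplex ℝ (G.Plan i), c ⬝ᵥ G.realization p
      + α * G.entropyDeriv (G.realization q) (G.realization p) = -k := by
    intro p hp
    rw [dotProduct_add_entropyDeriv c α hx hx' hp, hq.mixture_ratio_realization hα]
    have : ∀ σ, c ⬝ᵥ G.planVector σ + α * Real.log (q σ) = -k := fun σ => by linarith [hk σ]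
    simp only [this, ← Finset.sum_mul, hp.2, one_mul]
  rw [dotProduct_sub, entropyDeriv_sub]
  linarith [key q hq.1, key q' hq']

/-- Complementary slackness: each plan has nonnegative excess `f σ - k`, while the average excess
under strictly positive weights is zero. -/
theorem SolvesVI.isLogit [∀ i h, Nonempty (Act i h)] {c : Sequence Act i → ℝ}
    {α : ℝ} {x : Sequence Act i → ℝ} (h : G.SolvesVI c α x) :
    G.IsLogit c α (G.mixture (G.ratio x)) := by
  obtain ⟨⟨hx, hx'⟩, hvi⟩ := h
  have hp := mixture_ratio_mem hx hx'
  have hpos := G.mixture_pos _ (ratio_pos hx')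
  set k := c ⬝ᵥ x + α * G.entropyDeriv x x
  set f : G.Plan i → ℝ := fun σ =>
    c ⬝ᵥ G.planVector σ + α * Real.log (G.mixture (G.ratio x) σ)
  have hk : k = ∑ σ, G.mixture (G.ratio x) σ * f σ := by
    have := dotProduct_add_entropyDeriv c α hx hx' hp
    rwa [realization_mixture_ratio hx hx'] at this
  have hf : ∀ σ, 0 ≤ f σ - k := by
    intro σ
    have h1 := hvi _ (G.planVector_mem σ)
    have h2 : G.entropyDeriv x (G.planVector σ) = Real.log (G.mixture (G.ratio x) σ) := by
      rw [entropyDeriv_eq hx hx' (G.planVector_mem σ), log_mixture (ratio_pos hx')]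
    rw [dotProduct_sub, entropyDeriv_sub, h2] at h1
    simp only [f, k]
    linarith
  have hsum : ∑ σ, G.mixture (G.ratio x) σ * (f σ - k) = 0 := by
    simp only [mul_sub, Finset.sum_sub_distrib, ← Finset.sum_mul, hp.2]
    linarith
  rw [Finset.sum_eq_zero_iff_of_nonneg fun σ _ => mul_nonneg (hpos σ).le (hf σ)] at hsum
  refine ⟨hp, hpos, -k, fun σ => ?_⟩
  have := (mul_eq_zero.1 (hsum σ (Finset.mem_univ σ))).resolve_left (hpos σ).ne'
  simp only [f] at this
  linarith

theorem mem_viSolutions_iff (α : ℝ) (z : (Sequence Act 0 → ℝ) × (Sequence Act 1 → ℝ)) :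
    z ∈ viSolutions G.Z G.intDom (fun z => G.F z + α • grad G.psi z) ↔
      G.SolvesVI (G.F z).1 α z.1 ∧ G.SolvesVI (G.F z).2 α z.2 := by
  have hip : z ∈ G.intDom → ∀ v, ip (G.F z + α • grad G.psi z) v =
      ((G.F z).1 ⬝ᵥ v.1 + α * G.entropyDeriv z.1 v.1)
        + ((G.F z).2 ⬝ᵥ v.2 + α * G.entropyDeriv z.2 v.2) := by
    intro hz v
    rw [ip_add_left, ip_smul_left, ip_grad_psi hz, ip]
    ring
  have hzero : ∀ {i : Fin 2} (x : Sequence Act i → ℝ), G.entropyDeriv x 0 = 0 := fun x => by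
    simp [entropyDeriv]
  constructor
  · rintro ⟨⟨hz, hd⟩, hvi⟩
    have hd' := hd
    rw [intDom_eq] at hd'
    refine ⟨⟨⟨hz.1, hd'.1⟩, fun x' hx' => ?_⟩, ⟨⟨hz.2, hd'.2⟩, fun x' hx' => ?_⟩⟩
    · have := hvi (x', z.2) ⟨hx', hz.2⟩
      rw [hip hd] at this
      simpa [hzero] using this
    · have := hvi (z.1, x') ⟨hz.1, hx'⟩
      rw [hip hd] at this
      simpa [hzero] using this
  · rintro ⟨⟨⟨h1, h2⟩, h3⟩, ⟨⟨h4, h5⟩, h6⟩⟩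
    have hd : z ∈ G.intDom := by rw [intDom_eq]; exact ⟨h2, h5⟩
    refine ⟨⟨⟨h1, h4⟩, hd⟩, fun z' hz' => ?_⟩
    rw [hip hd]
    exact add_nonneg (h3 _ hz'.1) (h6 _ hz'.2)

end ZeroSumEFG

end Payoffs

section Convexity

variable {H : Fin 2 → Type*} {Act : ∀ i, H i → Type*}
  [∀ i, Fintype (H i)] [∀ i, DecidableEq (H i)]
  [∀ i h, Fintype (Act i h)] [∀ i h, DecidableEq (Act i h)]

namespace ZeroSumEFG

variable {G : ZeroSumEFG Act} {i : Fin 2}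

/-! ## Strong convexity of the dilated entropy -/

/-- The Bregman divergence of the dilated entropy dominates the weighted squared distance of the
policies. -/
theorem le_bregman_dilatedEntropy [∀ i h, Nonempty (Act i h)] {x x' : Sequence Act i → ℝ}
    (hx : x ∈ G.polytope i) (hx' : x' ∈ G.polytope i) (hpos : x' ∈ G.posDom i)
    {π : ∀ h : H i, Act i h → ℝ} (hπ : ∀ h, π h ∈ stdSimplex ℝ (Act i h))
    (hxπ : ∀ h a, x (some ⟨h, a⟩) = x (G.parent i h) * π h a) :
    ∑ h : H i, x (G.parent i h) * ((∑ a, (π h a - G.ratio x' h a) ^ 2) / 4)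
      ≤ G.dilatedEntropy i x - G.dilatedEntropy i x' - G.entropyDeriv x' (x - x') := by
  have h1 : G.dilatedEntropy i x = ∑ h : H i, x (G.parent i h) * ∑ a, π h a * Real.log (π h a) := by
    refine Finset.sum_congr rfl fun h _ => ?_
    rcases eq_or_ne (x (G.parent i h)) 0 with h0 | h0
    · rw [h0, zero_mul, zero_mul]
    · simp only [hxπ, mul_div_cancel_left₀ _ h0]
  -- Euler's identity: the dilated entropy is homogeneous of degree one.
  have h2 : G.entropyDeriv x' x' = G.dilatedEntropy i x' := by
    rw [entropyDeriv_eq hx' hpos hx', dilatedEntropy]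
    refine Finset.sum_congr rfl fun h _ => ?_
    rw [Finset.mul_sum]
    refine Finset.sum_congr rfl fun a _ => ?_
    rw [mul_ratio hpos h a, mul_assoc]
    congr 2 <;> rw [← mul_ratio hpos h a] <;> rfl
  rw [entropyDeriv_sub, h2, h1, entropyDeriv_eq hx' hpos hx, sub_sub_sub_cancel_right,
    ← Finset.sum_sub_distrib]
  refine Finset.sum_le_sum fun h _ => ?_
  have h3 := mul_le_mul_of_nonneg_left (sum_sq_sub_le_relativeEntropy (hπ h)
    (ratio_mem hx' hpos h) (ratio_pos hpos h)) (hx.1 (G.parent i h))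
  refine h3.trans_eq ?_
  rw [Finset.mul_sum, Finset.mul_sum, ← Finset.sum_sub_distrib]
  refine Finset.sum_congr rfl fun a _ => ?_
  rw [hxπ]
  ring

theorem l1_sq_le_bregman_dilatedEntropy [∀ i h, Nonempty (Act i h)] (G : ZeroSumEFG Act)
    (i : Fin 2) :
    ∃ C : ℝ, 0 < C ∧ ∀ x ∈ G.polytope i, ∀ x' ∈ G.polytope i, x' ∈ G.posDom i →
      l1 (x - x') ^ 2 ≤
        C * (G.dilatedEntropy i x - G.dilatedEntropy i x' - G.entropyDeriv x' (x - x')) := by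
  set K : ℝ := ∑ s : Sequence Act i, ((G.path s).length : ℝ)
  -- The summand `1` keeps the constant positive when there are no decision points.
  refine ⟨4 * K ^ 2 + 1, by positivity, fun x hx x' hx' hpos => ?_⟩
  obtain ⟨π, hπ, hxπ⟩ := exists_policy hx
  have hB := le_bregman_dilatedEntropy hx hx' hpos hπ hxπ
  set B := G.dilatedEntropy i x - G.dilatedEntropy i x' - G.entropyDeriv x' (x - x')
  have hterm : ∀ h : H i, 0 ≤ x (G.parent i h) * ((∑ a, (π h a - G.ratio x' h a) ^ 2) / 4) :=
    fun h => mul_nonneg (hx.1 _)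
      (div_nonneg (Finset.sum_nonneg fun _ _ => sq_nonneg _) (by norm_num))
  have hB0 : 0 ≤ B := (Finset.sum_nonneg fun h _ => hterm h).trans hB
  have hstep : ∀ h a, |x (G.parent i h) * (π h a - G.ratio x' h a)| ≤ 2 * √B := by
    intro h a
    have h1 : x (G.parent i h) * ((π h a - G.ratio x' h a) ^ 2 / 4) ≤ B := by
      refine le_trans (mul_le_mul_of_nonneg_left ?_ (hx.1 _))
        ((Finset.single_le_sum (fun h _ => hterm h) (Finset.mem_univ h)).trans hB)
      exact div_le_div_of_nonneg_right (Finset.single_le_sum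
        (f := fun a => (π h a - G.ratio x' h a) ^ 2) (fun _ _ => sq_nonneg _)
        (Finset.mem_univ a)) (by norm_num)
    refine abs_le_of_sq_le_sq ?_ (by positivity)
    rw [mul_pow, mul_pow, Real.sq_sqrt hB0]
    -- The weight is squared in the goal but enters the divergence linearly.
    have h2 : x (G.parent i h) ^ 2 ≤ x (G.parent i h) := by
      nlinarith [hx.1 (G.parent i h), le_one_of_mem_polytope hx (G.parent i h)]
    nlinarith [mul_le_mul_of_nonneg_right h2 (sq_nonneg (π h a - G.ratio x' h a))]
  have hdist : ∀ s, |x s - x' s| ≤ (G.path s).length * (2 * √B) := by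
    intro s
    refine G.seqInduction (P := fun s => |x s - x' s| ≤ (G.path s).length * (2 * √B)) ?_
      (fun h a ih => ?_) s
    · simp [hx.2.1, hx'.2.1, path]
    · have hr := ratio_mem hx' hpos h
      -- The inherited error is not amplified, as ratios are at most `1`; each step adds one local
      -- error of at most `2 * √B`.
      have h1 : x (some ⟨h, a⟩) - x' (some ⟨h, a⟩)
          = (x (G.parent i h) - x' (G.parent i h)) * G.ratio x' h a
            + x (G.parent i h) * (π h a - G.ratio x' h a) := by
        rw [hxπ, mul_ratio hpos h a]
        ring
      have h2 : |(x (G.parent i h) - x' (G.parent i h)) * G.ratio x' h a|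
          ≤ |x (G.parent i h) - x' (G.parent i h)| := by
        rw [abs_mul, abs_of_nonneg (hr.1 a)]
        exact mul_le_of_le_one_right (abs_nonneg _) (le_one_of_mem_stdSimplex hr a)
      have h3 : ((G.path (some ⟨h, a⟩)).length : ℝ) = (G.path (G.parent i h)).length + 1 := by
        rw [path_parent]
        simp [path]
      rw [h1, h3, add_mul, one_mul]
      exact (abs_add_le _ _).trans (add_le_add (h2.trans ih) (hstep h a))
  have hl1 : l1 (x - x') ≤ K * (2 * √B) := by
    rw [l1, Finset.sum_mul]
    exact Finset.sum_le_sum fun s _ => hdist s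
  calc l1 (x - x') ^ 2 ≤ (K * (2 * √B)) ^ 2 := pow_le_pow_left₀ (l1_nonneg _) hl1 2
    _ = 4 * K ^ 2 * B := by rw [mul_pow, mul_pow, Real.sq_sqrt hB0]; ring
    _ ≤ (4 * K ^ 2 + 1) * B := by linarith

theorem exists_stronglyConvexOver_psi [∀ i h, Nonempty (Act i h)] (G : ZeroSumEFG Act) :
    ∃ μ : ℝ, 0 < μ ∧ StronglyConvexOver G.psi G.Z G.intDom μ := by
  obtain ⟨C₀, hC₀, h₀⟩ := l1_sq_le_bregman_dilatedEntropy G 0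
  obtain ⟨C₁, hC₁, h₁⟩ := l1_sq_le_bregman_dilatedEntropy G 1
  refine ⟨2 / (C₀ + C₁), by positivity, fun x hx y hy => ?_⟩
  have hd := hy.2
  rw [intDom_eq] at hd
  have e₀ := h₀ _ hx.1 _ hy.1.1 hd.1
  have e₁ := h₁ _ hx.2 _ hy.1.2 hd.2
  rw [bregman, ip_grad_psi hy.2, prodNorm_sq, div_right_comm, div_self two_ne_zero,
    one_div, inv_mul_le_iff₀ (by positivity)]
  simp only [psi, Prod.fst_sub, Prod.snd_sub]
  have n₀ := nonneg_of_mul_nonneg_right ((sq_nonneg _).trans e₀) hC₀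
  have n₁ := nonneg_of_mul_nonneg_right ((sq_nonneg _).trans e₁) hC₁
  nlinarith [mul_nonneg hC₀.le n₁, mul_nonneg hC₁.le n₀]

/-! ## The operators -/

/-- The form is skew in `z - z'` and `v`, so it vanishes for `v = z - z'`. -/
theorem ip_F_sub (z z' v : (Sequence Act 0 → ℝ) × (Sequence Act 1 → ℝ)) :
    ip (G.F z - G.F z') v
      = v.1 ⬝ᵥ G.A *ᵥ (z - z').2 - (z - z').1 ⬝ᵥ G.A *ᵥ v.2 := by
  have h : G.F z - G.F z' = G.F (z - z') := by
    simp only [F, Prod.fst_sub, Prod.snd_sub, Matrix.mulVec_sub, Prod.mk_sub_mk]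
    congr 1
    abel
  rw [h, ip, F, neg_dotProduct, dotProduct_comm, Matrix.mulVec_transpose,
    ← Matrix.dotProduct_mulVec]
  exact (sub_eq_add_neg _ _).symm

theorem isMonotoneOp_F (G : ZeroSumEFG Act) : IsMonotoneOp G.F Set.univ 0 := by
  intro z _ z' _
  rw [ip_F_sub]
  simp

theorem isSmoothOp_F (G : ZeroSumEFG Act) :
    IsSmoothOp G.F Set.univ (⨆ p : Sequence Act 0 × Sequence Act 1, |G.A p.1 p.2|) := by
  intro z _ z' _
  set L := ⨆ p : Sequence Act 0 × Sequence Act 1, |G.A p.1 p.2|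
  have hL : ∀ s t, |G.A s t| ≤ L := fun s t =>
    le_ciSup (f := fun p : Sequence Act 0 × Sequence Act 1 => |G.A p.1 p.2|)
      (Set.finite_range _).bddAbove (s, t)
  have hL0 : 0 ≤ L := (abs_nonneg _).trans (hL none none)
  refine Real.sSup_le ?_ (mul_nonneg hL0 (Real.sqrt_nonneg _))
  rintro r ⟨v, hv, rfl⟩
  rw [ip_F_sub]
  generalize z - z' = w
  have h1 := (le_abs_self _).trans (abs_dotProduct_mulVec_le G.A hL v.1 w.2)
  have h2 := (neg_le_abs _).trans (abs_dotProduct_mulVec_le G.A hL w.1 v.2)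
  have hv' := prodNorm_sq v
  rw [hv, one_pow] at hv'
  -- Cauchy–Schwarz in the plane; the square supplied below is the remainder in Lagrange's identity.
  have h3 : l1 v.1 * l1 w.2 + l1 w.1 * l1 v.2 ≤ prodNorm w := by
    refine Real.le_sqrt_of_sq_le ?_
    nlinarith [sq_nonneg (l1 v.1 * l1 w.1 - l1 v.2 * l1 w.2)]
  nlinarith [mul_le_mul_of_nonneg_left h3 hL0]

theorem exists_isMonotoneOp [∀ i h, Nonempty (Act i h)] (G : ZeroSumEFG Act) {α : ℝ}
    (hα : 0 < α) : ∃ μ : ℝ, 0 < μ ∧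
      IsMonotoneOp (fun z => G.F z + α • grad G.psi z) (G.Z ∩ G.intDom) μ := by
  obtain ⟨μ, hμ, hconv⟩ := exists_stronglyConvexOver_psi G
  refine ⟨α * μ, mul_pos hα hμ, fun z hz z' hz' => ?_⟩
  -- Adding the two Bregman inequalities cancels the values of `ψ` and leaves the pairing of the
  -- gradient difference with `z - z'`.
  have h1 := hconv z hz.1 z' hz'
  have h2 := hconv z' hz'.1 z hz
  have h3 := isMonotoneOp_F G z trivial z' trivial
  rw [← neg_sub z z', prodNorm_neg, bregman, ← neg_sub z z', ip_neg_right] at h2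
  rw [bregman] at h1
  rw [zero_mul, ip_sub_left] at h3
  simp only [ip_sub_left, ip_add_left, ip_smul_left]
  nlinarith [mul_le_mul_of_nonneg_left (add_le_add h1 h2) hα.le]

/-! ## Equivalence of the two equilibrium problems -/

theorem bijOn_realizationPair [∀ i h, Nonempty (Act i h)] (G : ZeroSumEFG Act) {α : ℝ}
    (hα : 0 < α) : Set.BijOn G.realizationPair {m | G.IsQRE α m}
      (viSolutions G.Z G.intDom (fun z => G.F z + α • grad G.psi z)) := by
  refine ⟨fun m hm => ?_, fun m hm m' hm' heq => ?_, fun z hz => ?_⟩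
  · obtain ⟨h0, h1⟩ := (G.isQRE_iff hα m).1 hm
    exact (mem_viSolutions_iff α _).2 ⟨h0.solvesVI hα, h1.solvesVI hα⟩
  · obtain ⟨h0, h1⟩ := (G.isQRE_iff hα m).1 hm
    obtain ⟨h0', h1'⟩ := (G.isQRE_iff hα m').1 hm'
    obtain ⟨e0, e1⟩ := Prod.mk.inj heq
    funext k
    fin_cases k
    · change m 0 = m' 0
      rw [← h0.mixture_ratio_realization hα, e0, h0'.mixture_ratio_realization hα]
    · change m 1 = m' 1
      rw [← h1.mixture_ratio_realization hα, e1, h1'.mixture_ratio_realization hα]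
  · obtain ⟨h0, h1⟩ := (mem_viSolutions_iff α z).1 hz
    -- The nested `Fin.cases` packs the pair `z` into a dependent family over the two players.
    have hreal : G.realizationPair (fun k => G.mixture (G.ratio
        (Fin.cases (motive := fun k => Sequence Act k → ℝ) z.1
          (fun j => Fin.cases (motive := fun j => Sequence Act j.succ → ℝ) z.2
            (fun j => j.elim0) j) k))) = z :=
      Prod.ext (realization_mixture_ratio h0.1.1 h0.1.2)
        (realization_mixture_ratio h1.1.1 h1.1.2)
    refine ⟨_, (G.isQRE_iff hα _).2 ?_, hreal⟩
    rw [hreal]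
    exact ⟨h0.isLogit, h1.isLogit⟩

/-- A solution of the variational inequality is positive, so its ratios recover the given policy at
every decision point. -/
theorem isQRE_mixture_iff [∀ i h, Nonempty (Act i h)] (G : ZeroSumEFG Act) {α : ℝ}
    (hα : 0 < α) (π : ∀ (i : Fin 2) (h : H i), Act i h → ℝ)
    (hπ : ∀ i h, π i h ∈ stdSimplex ℝ (Act i h)) :
    G.IsQRE α (fun i => G.mixture (π i)) ↔ (G.sequenceForm (π 0), G.sequenceForm (π 1)) ∈
      viSolutions G.Z G.intDom (fun z => G.F z + α • grad G.psi z) := by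
  have hreal : G.realizationPair (fun i => G.mixture (π i))
      = (G.sequenceForm (π 0), G.sequenceForm (π 1)) :=
    Prod.ext (G.realization_mixture _ (hπ 0)) (G.realization_mixture _ (hπ 1))
  constructor
  · intro h
    exact hreal ▸ (bijOn_realizationPair G hα).mapsTo h
  · intro h
    obtain ⟨h0, h1⟩ := (mem_viSolutions_iff α _).1 h
    rw [isQRE_iff G hα, hreal]
    have l0 := h0.isLogit
    have l1 := h1.isLogit
    rw [ratio_sequenceForm h0.1.2] at l0
    rw [ratio_sequenceForm h1.1.2] at l1
    exact ⟨l0, l1⟩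

end ZeroSumEFG

end Convexity

end

theorem mainTheorem2 {H : Fin 2 → Type*} {Act : ∀ i, H i → Type*}
    [∀ i, Fintype (H i)] [∀ i, DecidableEq (H i)]
    [∀ i h, Fintype (Act i h)] [∀ i h, DecidableEq (Act i h)] [∀ i h, Nonempty (Act i h)]
    (G : ZeroSumEFG Act) :
    -- equivalence of the two problems, for mixed strategies and for policies
    (∀ α : ℝ, 0 < α →
      Set.BijOn G.realizationPair {m | G.IsQRE α m}
        (viSolutions G.Z G.intDom (fun z => G.F z + α • grad G.psi z)) ∧
      ∀ π : (∀ (i : Fin 2) (h : H i), Act i h → ℝ), (∀ i h, π i h ∈ stdSimplex ℝ (Act i h)) →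
        (G.IsQRE α (fun i => G.mixture (π i)) ↔
          (G.sequenceForm (π 0), G.sequenceForm (π 1)) ∈
            viSolutions G.Z G.intDom (fun z => G.F z + α • grad G.psi z))) ∧
    -- strong convexity of `ψ`
    (∀ z ∈ G.intDom, DifferentiableAt ℝ G.psi z) ∧
    (∃ μ : ℝ, 0 < μ ∧ StronglyConvexOver G.psi G.Z G.intDom μ) ∧
    -- monotonicity and smoothness of `F`
    IsMonotoneOp G.F Set.univ 0 ∧
    IsSmoothOp G.F Set.univ (⨆ p : Sequence Act 0 × Sequence Act 1, |G.A p.1 p.2|) ∧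
    -- strong monotonicity of `F + α ∇ψ`
    (∀ α : ℝ, 0 < α → ∃ μ : ℝ, 0 < μ ∧
      IsMonotoneOp (fun z => G.F z + α • grad G.psi z) (G.Z ∩ G.intDom) μ) := by
  exact ⟨fun α hα => ⟨G.bijOn_realizationPair hα, G.isQRE_mixture_iff hα⟩,
    fun _ => ZeroSumEFG.differentiableAt_psi, G.exists_stronglyConvexOver_psi, G.isMonotoneOp_F,
    G.isSmoothOp_F, fun _ => G.exists_isMonotoneOp⟩
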